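/- Let $m \geq 1$ be an integer. All functions are real-valued. Let $\dot H^{1/2}(\mathbb{R})$ be the space of all $f$ with $\int_{\mathbb{R}} \frac{|f(x)|}{1+x^2}\,dx < \infty$ and $$\|f\|_{\dot H^{1/2}}^2 = \frac{1}{2\pi} \iint_{\mathbb{R}\times\mathbb{R}} \frac{|f(x)-f(y)|^2}{|x-y|^2}\,dx\,dy < \infty ,$$ and write $(f, |\nabla| g) = \frac{1}{2\pi}\iint \frac{(f(x)-f(y))(g(x)-g(y))}{|x-y|^2}\,dx\,dy$, so that $(f,|\nabla| f) = \|f\|_{\dot H^{1/2}}^2$. Let $Q_m(x) = \left(\mathrm{i}\,\frac{x-\mathrm{i}}{x+\mathrm{i}}\right)^m$ and consider $$L_+ = |\nabla| - \frac{2m}{1+x^2}, \qquad L_- = L_+ + R, \qquad (Rf)(x) = \frac{1}{2\pi} \int_{\mathbb{R}} \frac{|Q_m(x)-Q_m(y)|^2}{|x-y|^2} f(y)\,dy .$$ As an operator on $L^2(\mathbb{R})$ with domain $H^1(\mathbb{R})$, $L_+$ has (up to scalar factors) exactly $2m$ eigenfunctions $\varphi_0, \ldots, \varphi_{2m-1}$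 with eigenvalues at most $0$; they are simple, with eigenvalues $E_0 < E_1 < \cdots < E_{2m-2} < E_{2m-1} = 0$. Moreover, $L_+$ has a zero energy resonance, i.e. a function $\varphi \in \dot H^{1/2}(\mathbb{R}) \setminus L^2(\mathbb{R})$ with $L_+\varphi = 0$. For any choice of such $\varphi_0,\dots,\varphi_{2m-1}$ and $\varphi$, set $$\psi_k = \varphi_k \ \ (0 \leq k \leq 2m-2), \qquad \psi_{2m-1} = \frac{\varphi_{2m-1}}{1+x^2}, \qquad \psi_{2m} = \frac{\varphi}{1+x^2} .$$ Then for $f \in \dot H^{1/2}(\mathbb{R})$ the integrals $\int \psi_k f\,dx$ and those defining $(f, L_\pm f)$ converge absolutely, and if $f, g \in \dot H^{1/2}(\mathbb{R})$ satisfy $$\int_{\mathbb{R}} \psi_k f\,dx = \int_{\mathbb{R}} \psi_k g\,dx = 0 \qquad \text{for } 0 \leq k \leq 2m ,$$ then $$(f, L_+ f) + (g, L_- g) \geq \frac{1}{m+1}\left( \|f\|_{\dot H^{1/2}}^2 + \|g\|_{\dot H^{1/2}}^2 \right).$$ The constant $\frac{1}{m+1}$ is optimal: no larger constant $c$ in its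 place makes the estimate true for all such $f, g$. -/

import Mathlib

open MeasureTheory

namespace HalfWave

noncomputable section

/-- The energy space `Ḣ^{1/2}(ℝ)`: real functions with `∫ |f(x)| / (1 + x²) dx < ∞` and finite
Gagliardo energy `∬ |f(x) - f(y)|² / |x - y|² dx dy < ∞`. -/
def MemHdotHalf (f : ℝ → ℝ) : Prop :=
  Integrable (fun x : ℝ => f x / (1 + x ^ 2)) ∧
    Integrable (fun p : ℝ × ℝ => (f p.1 - f p.2) ^ 2 / (p.1 - p.2) ^ 2)

/-- The bilinear form `(f, |∇| g) = (2π)⁻¹ ∬ (f(x) - f(y)) (g(x) - g(y)) / |x - y|² dx dy`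
of the half-Laplacian `|∇|` on `Ḣ^{1/2}(ℝ)`. -/
def halfLapForm (f g : ℝ → ℝ) : ℝ :=
  (1 / (2 * Real.pi)) *
    ∫ p : ℝ × ℝ, (f p.1 - f p.2) * (g p.1 - g p.2) / (p.1 - p.2) ^ 2

/-- The squared (semi)norm `‖f‖² = (f, |∇| f)` of `Ḣ^{1/2}(ℝ)`. -/
def hdotNormSq (f : ℝ → ℝ) : ℝ := halfLapForm f f

/-- The half-harmonic map `Q_m = f_m + i g_m`, `Q_m(x) = (i (x - i) / (x + i))^m`. The target
circle is the equator of the sphere, `(f_m, g_m, 0)`, so distances are those of `ℂ`. -/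
def Qmap (m : ℕ) (x : ℝ) : ℂ :=
  (Complex.I * (((x : ℂ) - Complex.I) / ((x : ℂ) + Complex.I))) ^ m

/-- The bilinear form `(f, L₊ g)` of `L₊ = |∇| - 2m / (1 + x²)`. -/
def LplusForm (m : ℕ) (f g : ℝ → ℝ) : ℝ :=
  halfLapForm f g - ∫ x : ℝ, 2 * (m : ℝ) / (1 + x ^ 2) * (f x * g x)

/-- The integral operator
`(R f)(x) = (2π)⁻¹ ∫ |Q_m(x) - Q_m(y)|² / |x - y|² f(y) dy`. -/
def Rop (m : ℕ) (f : ℝ → ℝ) (x : ℝ) : ℝ :=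
  (1 / (2 * Real.pi)) * ∫ y : ℝ, ‖Qmap m x - Qmap m y‖ ^ 2 / (x - y) ^ 2 * f y

/-- The bilinear form `(f, L₋ g)` of `L₋ = L₊ + R`. -/
def LminusForm (m : ℕ) (f g : ℝ → ℝ) : ℝ :=
  LplusForm m f g + ∫ x : ℝ, f x * Rop m g x

/-- Membership in the Sobolev space `H¹(ℝ)`: `f` is in `L²` and has a weak derivative in `L²`. -/
def MemH1 (f : ℝ → ℝ) : Prop :=
  MemLp f 2 ∧ ∃ f' : ℝ → ℝ, MemLp f' 2 ∧
    ∀ η : ℝ → ℝ, ContDiff ℝ (⊤ : ℕ∞) η → HasCompactSupport η →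
      ∫ x : ℝ, f x * deriv η x = - ∫ x : ℝ, f' x * η x

/-- `u ∈ Ḣ^{1/2}` is a weak solution of `L₊ u = E u`, tested against the functions of the form
domain `H^{1/2} = Ḣ^{1/2} ∩ L²` of `L₊`. -/
def SolvesLplus (m : ℕ) (E : ℝ) (u : ℝ → ℝ) : Prop :=
  MemHdotHalf u ∧ ∀ η : ℝ → ℝ, MemHdotHalf η → MemLp η 2 →
    LplusForm m η u = E * ∫ x : ℝ, η x * u x

/-- `u` is an `L²`-eigenfunction, with eigenvalue `E`, of the operator `L₊` with domain `H¹`. -/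
def IsEigenfunction (m : ℕ) (E : ℝ) (u : ℝ → ℝ) : Prop :=
  MemH1 u ∧ ¬ (u =ᵐ[volume] 0) ∧ SolvesLplus m E u

/-- `u` is a zero energy resonance of `L₊`: `L₊ u = 0` with `u ∈ Ḣ^{1/2} ∖ L²`. -/
def IsResonance (m : ℕ) (u : ℝ → ℝ) : Prop :=
  SolvesLplus m 0 u ∧ ¬ MemLp u 2

/-- `φ_0, …, φ_{2m-2}` are `L²`-eigenfunctions of `L₊` with eigenvalues
`E_0 < … < E_{2m-2} < 0`, `φ_{2m-1}` is an `L²`-eigenfunction with eigenvalue `E_{2m-1} = 0`, and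
`χ` is a zero energy resonance. -/
structure IsBoundStateFamily (m : ℕ) (E : Fin (2 * m) → ℝ) (φ : Fin (2 * m) → ℝ → ℝ)
    (χ : ℝ → ℝ) : Prop where
  strictMono : StrictMono E
  neg : ∀ k : Fin (2 * m), (k : ℕ) + 1 < 2 * m → E k < 0
  zero : ∀ k : Fin (2 * m), (k : ℕ) + 1 = 2 * m → E k = 0
  eigen : ∀ k, IsEigenfunction m (E k) (φ k)
  resonance : IsResonance m χ

/-- The `2m + 1` functions `ψ_k`: `ψ_k = φ_k` for `0 ≤ k ≤ 2m - 2`,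
`ψ_{2m-1} = φ_{2m-1} / (1 + x²)` and `ψ_{2m} = χ / (1 + x²)`. -/
def psi (m : ℕ) (φ : Fin (2 * m) → ℝ → ℝ) (χ : ℝ → ℝ) (k : Fin (2 * m + 1)) (x : ℝ) : ℝ :=
  if h : (k : ℕ) < 2 * m then
    if (k : ℕ) + 1 < 2 * m then φ ⟨k, h⟩ x else φ ⟨k, h⟩ x / (1 + x ^ 2)
  else χ x / (1 + x ^ 2)

/-- The orthogonality conditions `∫ ψ_k f dx = 0` for `0 ≤ k ≤ 2m`. -/
def OrthPsi (m : ℕ) (φ : Fin (2 * m) → ℝ → ℝ) (χ f : ℝ → ℝ) : Prop :=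
  ∀ k : Fin (2 * m + 1), ∫ x : ℝ, psi m φ χ k x * f x = 0

end

end HalfWave

/-!
The substitution `x = tan (θ / 2)` turns `dx / (π (1 + x²))` into the Haar probability measure of
the circle, the weight `2 / (1 + x²)` into `1 + cos θ`, and `|∇|` into the multiplier `|n|` in the
Hartley basis `cas n = cos nθ + sin nθ`, so that `(f, L₊ g) = 2π ∑ (|n| - m) f̂(n) ĝ(n)`.

The equation `L₊ u = 0` leaves only the frequencies `±m`, while the eigenfunctions with negative
eigenvalue are `1 + cos θ` times a Hartley polynomial of degree less than `m`, whose coefficients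
are an eigenvector of a Jacobi matrix of size `2m - 1`, which has simple spectrum. Hence
orthogonality to all `ψ_k` means that `f̂(n) = 0` for `|n| ≤ m`. On the remaining frequencies
`|n| - m ≥ |n| / (m + 1)`, with equality for `|n| = m + 1`. Finally
`(f, R f) = 2π ∑ f̂(j - k)²`, summed over `0 ≤ j, k < m`, is nonnegative.
-/

namespace HalfWave

noncomputable section

open AddCircle ProbabilityTheory
open scoped ENNReal Finset

/-! ### The Gagliardo energy on the circle -/

section Circle

variable {T : ℝ}

lemma fourier_apply_add (n : ℤ) (s t : AddCircle T) :
    (fourier n (s + t) : ℂ) = fourier n s * fourier n t := by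
  simp only [fourier_apply, smul_add, toCircle_add, Circle.coe_mul]

lemma norm_fourier_apply (n : ℤ) (t : AddCircle T) : ‖(fourier n t : ℂ)‖ = 1 :=
  Circle.norm_coe _

lemma fourier_natCast_apply (n : ℕ) (t : AddCircle T) :
    (fourier (n : ℤ) t : ℂ) = fourier 1 t ^ n := by
  rw [fourier_apply, natCast_zsmul, toCircle_nsmul, Circle.coe_pow, fourier_one]

lemma enorm_div_fourier_add_sub_fourier_sq (z : ℂ) (n : ℤ) (y h : AddCircle T) :
    ‖z / (fourier n (y + h) - fourier n y)‖ₑ ^ 2 =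
      ‖(fourier n h - 1 : ℂ)⁻¹‖ₑ ^ 2 * ‖z‖ₑ ^ 2 := by
  have hnorm : ‖(fourier n (y + h) - fourier n y : ℂ)⁻¹‖ₑ = ‖(fourier n h - 1 : ℂ)⁻¹‖ₑ := by
    rw [fourier_apply_add, ← mul_sub_one, ← ofReal_norm, ← ofReal_norm,
      norm_inv, norm_mul, norm_fourier_apply, one_mul, norm_inv]
  rw [div_eq_mul_inv, enorm_mul, hnorm, mul_pow, mul_comm]

variable [Fact (0 < T)]

lemma fourier_one_eq_one_iff {t : AddCircle T} : (fourier 1 t : ℂ) = 1 ↔ t = 0 := by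
  rw [fourier_one, Circle.coe_eq_one, ← toCircle_zero (T := T),
    (injective_toCircle (Fact.out : 0 < T).ne').eq_iff]

lemma lintegral_enorm_sq_eq_tsum_fourierCoeff {F : AddCircle T → ℂ} (hF : MemLp F 2 haarAddCircle) :
    ∫⁻ t, ‖F t‖ₑ ^ 2 ∂haarAddCircle = ∑' n : ℤ, ‖fourierCoeff F n‖ₑ ^ 2 := by
  have hsum : HasSum (fun n : ℤ => ‖fourierCoeff F n‖ ^ 2) (∫ t, ‖F t‖ ^ 2 ∂haarAddCircle) := by
    have h := hasSum_sq_fourierCoeff hF.toLp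
    rwa [fourierCoeff_congr_ae hF.coeFn_toLp, integral_congr_ae (g := fun t => ‖F t‖ ^ 2)
      (hF.coeFn_toLp.mono fun t ht => by simp only [ht])] at h
  have henorm (z : ℂ) : ‖z‖ₑ ^ 2 = ENNReal.ofReal (‖z‖ ^ 2) := by
    rw [ENNReal.ofReal_pow (norm_nonneg z), ofReal_norm]
  simp only [henorm]
  rw [← ofReal_integral_eq_lintegral_ofReal ((memLp_two_iff_integrable_sq_norm hF.1).1 hF)
    (.of_forall fun t => by positivity), ← hsum.tsum_eq,
    ENNReal.ofReal_tsum_of_nonneg (fun n => by positivity) hsum.summable]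

lemma fourierCoeff_comp_add_right (F : AddCircle T → ℂ) (h : AddCircle T) (n : ℤ) :
    fourierCoeff (fun t => F (t + h)) n = fourier n h * fourierCoeff F n := by
  have hshift (t : AddCircle T) :
      (fourier (-n) t : ℂ) = fourier n h * fourier (-n) (t + h) := by
    rw [fourier_apply_add, mul_left_comm, ← fourier_add, add_neg_cancel, fourier_zero, mul_one]
  unfold fourierCoeff
  rw [← integral_const_mul,
    ← integral_add_right_eq_self (fun t => fourier n h * (fourier (-n) t • F t)) h]
  exact integral_congr_ae (.of_forall fun t => by
    simp only [hshift t, smul_eq_mul, mul_assoc])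

lemma lintegral_enorm_comp_add_right_sub_sq {F : AddCircle T → ℂ} (hF : MemLp F 2 haarAddCircle)
    (h : AddCircle T) :
    ∫⁻ t, ‖F (t + h) - F t‖ₑ ^ 2 ∂haarAddCircle =
      ∑' n : ℤ, ‖(fourier n h : ℂ) - 1‖ₑ ^ 2 * ‖fourierCoeff F n‖ₑ ^ 2 := by
  have hFh : MemLp (fun t => F (t + h)) 2 haarAddCircle :=
    hF.comp_measurePreserving (measurePreserving_add_right _ h)
  refine (lintegral_enorm_sq_eq_tsum_fourierCoeff (hFh.sub hF)).trans (tsum_congr fun n => ?_)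
  have hcoeff : fourierCoeff ((fun t => F (t + h)) - F) n =
      (fourier n h - 1) * fourierCoeff F n := by
    rw [sub_eq_add_neg, ← neg_one_smul ℂ F, fourierCoeff.add (hFh.integrable one_le_two)
      ((hF.integrable one_le_two).smul _), Pi.add_apply, fourierCoeff.const_smul,
      fourierCoeff_comp_add_right, smul_eq_mul]
    ring
  rw [hcoeff, enorm_mul, mul_pow]

lemma haarAddCircle_singleton (t : AddCircle T) : haarAddCircle {t} = 0 := by
  have h := AddCircle.volume_closedBall T (x := t) 0
  have hT : 0 < T := Fact.out
  simpa [AddCircle.volume_eq_smul_haarAddCircle, hT.not_ge] using h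

lemma lintegral_enorm_sum_fourier_sq (s : Finset ℤ) :
    ∫⁻ t : AddCircle T, ‖∑ j ∈ s, (fourier j t : ℂ)‖ₑ ^ 2 ∂haarAddCircle = #s := by
  have hcont (j : ℤ) : Continuous (fourier j : AddCircle T → ℂ) := (fourier j).continuous
  have hL2 : MemLp (fun t : AddCircle T => ∑ j ∈ s, (fourier j t : ℂ)) 2 haarAddCircle :=
    (continuous_finsetSum _ fun j _ => hcont j).memLp_of_hasCompactSupport (.of_compactSpace _)
  have hcoeff (n : ℤ) : fourierCoeff (fun t : AddCircle T => ∑ j ∈ s, (fourier j t : ℂ)) n =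
      if n ∈ s then 1 else 0 := by
    have h := congrFun (fourierCoeff.sum s (fun j => ⇑(fourier (T := T) j)) fun j _ =>
      (hcont j).integrable_of_hasCompactSupport (.of_compactSpace _)) n
    simp only [Finset.sum_apply, fourierCoeff_fourier, Finset.sum_pi_single] at h
    rw [← h]
    congr 1
    ext t
    simp only [Finset.sum_apply]
  rw [lintegral_enorm_sq_eq_tsum_fourierCoeff hL2,
    tsum_eq_sum (s := s) fun n hn => by rw [hcoeff, if_neg hn]; simp,
    Finset.sum_congr rfl fun n hn => by rw [hcoeff, if_pos hn, enorm_one, one_pow],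
    Finset.sum_const, nsmul_one]

-- The quotient is, up to a unimodular factor, a sum of `|n|` distinct characters.
lemma lintegral_enorm_fourier_sub_one_div_sq (n : ℤ) :
    ∫⁻ h : AddCircle T, ‖((fourier n h : ℂ) - 1) / (fourier 1 h - 1)‖ₑ ^ 2 ∂haarAddCircle =
      n.natAbs := by
  have hne : ∀ᵐ h : AddCircle T ∂haarAddCircle, h ≠ 0 :=
    compl_mem_ae_iff.2 (haarAddCircle_singleton 0)
  have hnat (k : ℕ) :
      ∫⁻ h : AddCircle T, ‖((fourier (k : ℤ) h : ℂ) - 1) / (fourier 1 h - 1)‖ₑ ^ 2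
        ∂haarAddCircle = k := by
    have hgeom : ∀ᵐ h : AddCircle T ∂haarAddCircle,
        ((fourier (k : ℤ) h : ℂ) - 1) / (fourier 1 h - 1) =
          ∑ j ∈ (Finset.range k).map Nat.castEmbedding, fourier j h := by
      filter_upwards [hne] with h hh
      rw [fourier_natCast_apply, ← geom_sum_eq (mt fourier_one_eq_one_iff.1 hh), Finset.sum_map]
      exact Finset.sum_congr rfl fun j _ => (fourier_natCast_apply j h).symm
    calc ∫⁻ h : AddCircle T, ‖((fourier (k : ℤ) h : ℂ) - 1) / (fourier 1 h - 1)‖ₑ ^ 2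
          ∂haarAddCircle
        = ∫⁻ h : AddCircle T, ‖∑ j ∈ (Finset.range k).map Nat.castEmbedding,
            (fourier j h : ℂ)‖ₑ ^ 2 ∂haarAddCircle :=
          lintegral_congr_ae (hgeom.mono fun h hh => by simp only [hh])
      _ = k := by rw [lintegral_enorm_sum_fourier_sq, Finset.card_map, Finset.card_range]
  obtain ⟨k, rfl | rfl⟩ := n.eq_nat_or_neg
  · exact hnat k
  · rw [Int.natAbs_neg, Int.natAbs_natCast, ← hnat k]
    congr with h
    have hconj : (fourier (-(k : ℤ)) h : ℂ) - 1 = (starRingEnd ℂ) (fourier (k : ℤ) h - 1) := by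
      rw [fourier_neg, map_sub, map_one]
    rw [div_eq_mul_inv, div_eq_mul_inv, enorm_mul, enorm_mul, hconj, RCLike.enorm_conj]

lemma lintegral_gagliardo_circle_of_measurable {F : AddCircle T → ℂ} (hm : Measurable F)
    (hF : MemLp F 2 haarAddCircle) :
    ∫⁻ p : AddCircle T × AddCircle T, ‖(F p.1 - F p.2) / (fourier 1 p.1 - fourier 1 p.2)‖ₑ ^ 2
        ∂(haarAddCircle.prod haarAddCircle) =
      ∑' n : ℤ, n.natAbs * ‖fourierCoeff F n‖ₑ ^ 2 := by
  have hfour (n : ℤ) : Measurable (fourier n : AddCircle T → ℂ) := (fourier n).continuous.measurable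
  calc ∫⁻ p : AddCircle T × AddCircle T, ‖(F p.1 - F p.2) / (fourier 1 p.1 - fourier 1 p.2)‖ₑ ^ 2
        ∂(haarAddCircle.prod haarAddCircle)
      = ∫⁻ y, ∫⁻ h, ‖(F (y + h) - F y) / (fourier 1 (y + h) - fourier 1 y)‖ₑ ^ 2
          ∂haarAddCircle ∂haarAddCircle := by
        rw [lintegral_prod_symm' _ (by fun_prop)]
        exact lintegral_congr fun y => (lintegral_add_left_eq_self (μ := haarAddCircle) _ y).symm
    _ = ∫⁻ h, ‖(fourier 1 h - 1 : ℂ)⁻¹‖ₑ ^ 2 * ∫⁻ y, ‖F (y + h) - F y‖ₑ ^ 2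
          ∂haarAddCircle ∂haarAddCircle := by
        rw [lintegral_lintegral_swap (by fun_prop)]
        simp only [enorm_div_fourier_add_sub_fourier_sq]
        exact lintegral_congr fun h => lintegral_const_mul _ (by fun_prop)
    _ = ∫⁻ h, ∑' n : ℤ, ‖((fourier n h : ℂ) - 1) / (fourier 1 h - 1)‖ₑ ^ 2 *
          ‖fourierCoeff F n‖ₑ ^ 2 ∂haarAddCircle := by
        refine lintegral_congr fun h => ?_
        rw [lintegral_enorm_comp_add_right_sub_sq hF, ← ENNReal.tsum_mul_left]
        congr with n
        rw [div_eq_inv_mul, enorm_mul, mul_pow, mul_assoc]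
    _ = ∑' n : ℤ, n.natAbs * ‖fourierCoeff F n‖ₑ ^ 2 := by
        rw [lintegral_tsum fun n => by fun_prop]
        congr with n
        rw [lintegral_mul_const _ (by fun_prop), lintegral_enorm_fourier_sub_one_div_sq]

lemma lintegral_gagliardo_circle {F : AddCircle T → ℂ} (hF : MemLp F 2 haarAddCircle) :
    ∫⁻ p : AddCircle T × AddCircle T, ‖(F p.1 - F p.2) / (fourier 1 p.1 - fourier 1 p.2)‖ₑ ^ 2
        ∂(haarAddCircle.prod haarAddCircle) =
      ∑' n : ℤ, n.natAbs * ‖fourierCoeff F n‖ₑ ^ 2 := by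
  obtain ⟨G, hG, hFG⟩ := hF.1
  rw [fourierCoeff_congr_ae hFG,
    ← lintegral_gagliardo_circle_of_measurable hG.measurable ((memLp_congr_ae hFG).1 hF)]
  refine lintegral_congr_ae ?_
  filter_upwards [Measure.quasiMeasurePreserving_fst.ae hFG,
    Measure.quasiMeasurePreserving_snd.ae hFG] with p h₁ h₂
  rw [h₁, h₂]

end Circle

/-! ### The Cauchy measure and stereographic projection -/

local notation "ν" => cauchyMeasure 0 1

lemma cauchyMeasure_zero_one :
    ν = volume.withDensity fun x : ℝ => ENNReal.ofReal (Real.pi⁻¹ * (1 + x ^ 2)⁻¹) := by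
  rw [cauchyMeasure_of_scale_ne_zero 0 one_ne_zero]
  congr with x
  simp [cauchyPDF, cauchyPDFReal, add_comm]

lemma cauchyMeasure_absolutelyContinuous : ν ≪ volume := by
  rw [cauchyMeasure_zero_one]
  exact withDensity_absolutelyContinuous _ _

lemma absolutelyContinuous_cauchyMeasure : volume ≪ ν := by
  rw [cauchyMeasure_zero_one]
  refine withDensity_absolutelyContinuous' (by fun_prop) (.of_forall fun x => ?_)
  exact (ENNReal.ofReal_pos.2 (by positivity)).ne'

lemma integrable_cauchyMeasure_iff {f : ℝ → ℝ} :
    Integrable f ν ↔ Integrable fun x => f x / (1 + x ^ 2) := by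
  rw [cauchyMeasure_zero_one, integrable_withDensity_iff (by fun_prop) (by simp),
    ← integrable_const_mul_iff (c := Real.pi⁻¹) (by simp [Real.pi_ne_zero])
      (fun x => f x / (1 + x ^ 2))]
  refine iff_of_eq (congrArg (Integrable · volume) (funext fun x => ?_))
  rw [ENNReal.toReal_ofReal (by positivity), mul_left_comm, div_eq_mul_inv]

lemma integral_div_one_add_sq_mul (c : ℝ) (f : ℝ → ℝ) :
    ∫ x, c / (1 + x ^ 2) * f x = c * Real.pi * ∫ x, f x ∂ν := by
  rw [cauchyMeasure_zero_one, integral_withDensity_eq_integral_toReal_smul (by fun_prop) (by simp),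
    ← integral_const_mul]
  refine integral_congr_ae (.of_forall fun x => ?_)
  simp only [ENNReal.toReal_ofReal (show 0 ≤ Real.pi⁻¹ * (1 + x ^ 2)⁻¹ by positivity), smul_eq_mul]
  field_simp

lemma integrable_div_one_add_sq_mul {f : ℝ → ℝ} (hf : Integrable f ν) (c : ℝ) :
    Integrable fun x => c / (1 + x ^ 2) * f x := by
  refine ((integrable_cauchyMeasure_iff.1 hf).const_mul c).congr (.of_forall fun x => ?_)
  simp only [div_mul_eq_mul_div, mul_div_assoc]

/-- The inverse stereographic projection of the line on the circle, `x ↦ θ = 2 arctan x`, in units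
of a full turn. -/
def toAddCircle (x : ℝ) : UnitAddCircle := (Real.arctan x / Real.pi : ℝ)

/-- The stereographic projection `θ ↦ tan (θ / 2)` of the circle on the line, with the point at
infinity sent to the junk value `0`. -/
def ofAddCircle : UnitAddCircle → ℝ :=
  Function.Periodic.lift (f := fun t : ℝ => Real.tan (t * Real.pi)) (c := 1) fun t => by
    simp only [add_mul, one_mul, Real.tan_add_pi]

lemma ofAddCircle_toAddCircle (x : ℝ) : ofAddCircle (toAddCircle x) = x :=
  calc Real.tan (Real.arctan x / Real.pi * Real.pi) = x := by
        rw [div_mul_cancel₀ _ Real.pi_ne_zero, Real.tan_arctan]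

lemma range_arctan_div_pi :
    Set.range (fun x => Real.arctan x / Real.pi) = Set.Ioo (-(1 / 2)) (-(1 / 2) + 1) := by
  rw [show (fun x => Real.arctan x / Real.pi) = (· / Real.pi) ∘ Real.arctan from rfl,
    Set.range_comp, Real.range_arctan]
  simp only [div_eq_mul_inv]
  rw [Set.image_mul_right_Ioo _ _ (inv_pos.2 Real.pi_pos)]
  congr 1
  · field_simp
  · field_simp
    norm_num

lemma map_arctan_div_pi_cauchyMeasure :
    Measure.map (fun x => Real.arctan x / Real.pi) ν =
      volume.restrict (Set.Ioo (-(1 / 2)) (-(1 / 2) + 1)) := by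
  have hderiv (x : ℝ) : HasDerivAt (fun x => Real.arctan x / Real.pi)
      (Real.pi⁻¹ * (1 + x ^ 2)⁻¹) x := by
    simpa only [one_div, div_eq_inv_mul, mul_one] using (Real.hasDerivAt_arctan x).div_const Real.pi
  have hinj : Function.Injective fun x => Real.arctan x / Real.pi := fun x y h =>
    Real.arctan_injective ((div_left_inj' Real.pi_ne_zero).1 h)
  have h := map_withDensity_abs_det_fderiv_eq_addHaar volume MeasurableSet.univ.nullMeasurableSet
    (fun x _ => (hderiv x).hasFDerivAt.hasFDerivWithinAt) hinj.injOn
  rw [Set.image_univ, range_arctan_div_pi, Measure.restrict_univ] at h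
  rw [← h, cauchyMeasure_zero_one]
  congr with x
  simp only [ContinuousLinearMap.det_toSpanSingleton]
  rw [abs_of_nonneg (by positivity)]

lemma measurePreserving_toAddCircle : MeasurePreserving toAddCircle ν haarAddCircle := by
  have hhaar : (haarAddCircle : Measure UnitAddCircle) = volume := by
    simp [AddCircle.volume_eq_smul_haarAddCircle]
  rw [hhaar]
  refine (UnitAddCircle.measurePreserving_mk (-(1 / 2))).comp
    (f := fun x => Real.arctan x / Real.pi) ⟨by fun_prop, ?_⟩
  rw [map_arctan_div_pi_cauchyMeasure, restrict_Ioo_eq_restrict_Ioc]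

lemma measurableEmbedding_toAddCircle : MeasurableEmbedding toAddCircle :=
  measurePreserving_toAddCircle.measurable.measurableEmbedding
    (Function.LeftInverse.injective ofAddCircle_toAddCircle)

lemma continuous_toAddCircle : Continuous toAddCircle :=
  (AddCircle.continuous_mk' 1).comp (by fun_prop)

lemma fourier_toAddCircle (n : ℤ) (x : ℝ) :
    (fourier n (toAddCircle x) : ℂ) = Complex.exp ((2 * n * Real.arctan x : ℝ) * Complex.I) := by
  have hpi : (Real.pi : ℂ) ≠ 0 := Complex.ofReal_ne_zero.2 Real.pi_ne_zero
  rw [toAddCircle, fourier_coe_apply]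
  congr 1
  push_cast
  field_simp

lemma one_sub_mul_I_ne_zero (x : ℝ) : (1 : ℂ) - x * Complex.I ≠ 0 := fun h => by
  simpa using congrArg Complex.re h

lemma fourier_one_toAddCircle (x : ℝ) :
    (fourier 1 (toAddCircle x) : ℂ) = (1 + x * Complex.I) / (1 - x * Complex.I) := by
  have hexp (x : ℝ) : Complex.exp (Real.arctan x * Complex.I) =
      Real.cos (Real.arctan x) * (1 + x * Complex.I) := by
    have hsin : Real.sin (Real.arctan x) = Real.cos (Real.arctan x) * x := by
      rw [Real.sin_arctan, Real.cos_arctan, one_div, div_eq_inv_mul]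
    rw [Complex.exp_mul_I, ← Complex.ofReal_cos, ← Complex.ofReal_sin, hsin]
    push_cast
    ring
  have hcos : (Real.cos (Real.arctan x) : ℂ) ≠ 0 :=
    Complex.ofReal_ne_zero.2 (Real.cos_arctan_pos x).ne'
  have hneg := hexp (-x)
  rw [Real.arctan_neg, Real.cos_neg, Complex.ofReal_neg, Complex.ofReal_neg, neg_mul, neg_mul,
    ← sub_eq_add_neg] at hneg
  rw [fourier_toAddCircle, ← mul_div_mul_left _ _ hcos, ← hexp, ← hneg, ← Complex.exp_sub]
  congr 1
  push_cast
  ring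

lemma norm_fourier_one_sub_sq (x y : ℝ) :
    ‖(fourier 1 (toAddCircle x) : ℂ) - fourier 1 (toAddCircle y)‖ ^ 2 =
      4 * (x - y) ^ 2 / ((1 + x ^ 2) * (1 + y ^ 2)) := by
  have hnorm (x : ℝ) : ‖(1 : ℂ) - x * Complex.I‖ ^ 2 = 1 + x ^ 2 := by
    rw [← Complex.normSq_eq_norm_sq, Complex.normSq_apply]
    simp
    ring
  have hnum : (1 + (x : ℂ) * Complex.I) * (1 - y * Complex.I) -
      (1 - x * Complex.I) * (1 + y * Complex.I) = (2 * (x - y) : ℝ) * Complex.I := by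
    push_cast
    ring
  rw [fourier_one_toAddCircle, fourier_one_toAddCircle,
    div_sub_div _ _ (one_sub_mul_I_ne_zero x) (one_sub_mul_I_ne_zero y), hnum, norm_div, div_pow,
    norm_mul, norm_mul, mul_pow, mul_pow, hnorm, hnorm, Complex.norm_I, Complex.norm_real,
    Real.norm_eq_abs, sq_abs]
  ring

/-! ### The Hartley basis -/

lemma enorm_sq_eq_ofReal (x : ℝ) : ‖x‖ₑ ^ 2 = ENNReal.ofReal (x ^ 2) := by
  rw [← enorm_pow, Real.enorm_of_nonneg (sq_nonneg x)]

lemma enorm_ofReal (x : ℝ) : ‖(x : ℂ)‖ₑ = ‖x‖ₑ := by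
  simp only [enorm_eq_nnnorm, Complex.nnnorm_real]

lemma memLp_two_iff_lintegral_enorm_sq {α E : Type*} [MeasurableSpace α] [NormedAddCommGroup E]
    {μ : Measure α} {f : α → E} (hf : AEStronglyMeasurable f μ) :
    MemLp f 2 μ ↔ ∫⁻ x, ‖f x‖ₑ ^ 2 ∂μ < ⊤ := by
  rw [MemLp, and_iff_right hf,
    eLpNorm_lt_top_iff_lintegral_rpow_enorm_lt_top two_ne_zero ENNReal.ofNat_ne_top]
  simp only [ENNReal.toReal_ofNat, ENNReal.rpow_ofNat]

lemma hasSum_of_lintegral_enorm_sq_eq_tsum {α ι : Type*} [MeasurableSpace α] {μ : Measure α}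
    {f : α → ℝ} (hf : MemLp f 2 μ) {a : ι → ℝ} (ha : ∀ i, 0 ≤ a i)
    (h : ∫⁻ x, ‖f x‖ₑ ^ 2 ∂μ = ∑' i, ENNReal.ofReal (a i)) : HasSum a (∫ x, f x ^ 2 ∂μ) := by
  have hne : ∑' i, ENNReal.ofReal (a i) ≠ ⊤ :=
    h ▸ ((memLp_two_iff_lintegral_enorm_sq hf.1).1 hf).ne
  have hsum : HasSum a (∑' i, ENNReal.ofReal (a i)).toReal := by
    have h := ENNReal.hasSum_toReal hne
    rw [← ENNReal.tsum_toReal_eq (ENNReal.ne_top_of_tsum_ne_top hne)] at h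
    simpa only [ENNReal.toReal_ofReal (ha _)] using h
  rwa [integral_eq_lintegral_of_nonneg_ae (.of_forall fun x => sq_nonneg _)
    hf.integrable_sq.aestronglyMeasurable, ← lintegral_congr fun x => enorm_sq_eq_ofReal (f x), h]

lemma integral_mul_eq_polarization {α : Type*} [MeasurableSpace α] {μ : Measure α} {f g : α → ℝ}
    (hf : MemLp f 2 μ) (hg : MemLp g 2 μ) :
    ∫ x, f x * g x ∂μ = 1 / 4 * (∫ x, (f + g) x ^ 2 ∂μ - ∫ x, (f - g) x ^ 2 ∂μ) := by
  rw [← integral_sub (hf.add hg).integrable_sq (hf.sub hg).integrable_sq, ← integral_const_mul]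
  congr with x
  simp only [Pi.add_apply, Pi.sub_apply]
  ring

/-- The Hartley functions `cos nθ + sin nθ`, `θ = 2 arctan x`: a real orthonormal basis of
`L²` of the Cauchy measure, indexed by `ℤ`. -/
def cas (n : ℤ) (x : ℝ) : ℝ :=
  Real.cos (2 * n * Real.arctan x) + Real.sin (2 * n * Real.arctan x)

/-- The coefficients of a function with respect to the Hartley functions. -/
def casCoeff (f : ℝ → ℝ) (n : ℤ) : ℝ := ∫ x, f x * cas n x ∂ν

@[fun_prop]
lemma continuous_cas (n : ℤ) : Continuous (cas n) := by unfold cas; fun_prop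

lemma abs_cas_le (n : ℤ) (x : ℝ) : |cas n x| ≤ 2 :=
  (abs_add_le _ _).trans
    ((add_le_add (Real.abs_cos_le_one _) (Real.abs_sin_le_one _)).trans_eq one_add_one_eq_two)

lemma integrable_mul_cas {μ : Measure ℝ} {f : ℝ → ℝ} (hf : Integrable f μ) (n : ℤ) :
    Integrable (fun x => f x * cas n x) μ :=
  hf.mul_bdd (c := 2) (by fun_prop) (.of_forall fun x => abs_cas_le n x)

lemma memLp_cas (n : ℤ) : MemLp (cas n) 2 ν :=
  .of_bound (by fun_prop) 2 (.of_forall fun x => abs_cas_le n x)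

lemma casCoeff_congr {f g : ℝ → ℝ} (h : f =ᵐ[volume] g) : casCoeff f = casCoeff g := by
  ext n
  exact integral_congr_ae ((cauchyMeasure_absolutelyContinuous.ae_eq h).mono fun x hx => by
    simp only [hx])

lemma casCoeff_add {f g : ℝ → ℝ} (hf : Integrable f ν) (hg : Integrable g ν) :
    casCoeff (f + g) = casCoeff f + casCoeff g := by
  ext n
  simp only [casCoeff, Pi.add_apply, add_mul]
  exact integral_add (integrable_mul_cas hf n) (integrable_mul_cas hg n)

lemma casCoeff_smul (c : ℝ) (f : ℝ → ℝ) : casCoeff (c • f) = c • casCoeff f := by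
  ext n
  simp only [casCoeff, Pi.smul_apply, smul_eq_mul, mul_assoc]
  exact integral_const_mul c _

lemma casCoeff_sub {f g : ℝ → ℝ} (hf : Integrable f ν) (hg : Integrable g ν) :
    casCoeff (f - g) = casCoeff f - casCoeff g := by
  ext n
  simp only [casCoeff, Pi.sub_apply, sub_mul]
  exact integral_sub (integrable_mul_cas hf n) (integrable_mul_cas hg n)

lemma fourierCoeff_comp_ofAddCircle (f : ℝ → ℝ) (n : ℤ) :
    fourierCoeff (fun t => (f (ofAddCircle t) : ℂ)) n =
      ∫ x, (fourier (-n) (toAddCircle x) : ℂ) * f x ∂ν := by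
  unfold fourierCoeff
  rw [← measurePreserving_toAddCircle.integral_comp measurableEmbedding_toAddCircle]
  simp only [ofAddCircle_toAddCircle, smul_eq_mul]

lemma fourierCoeff_comp_ofAddCircle_neg (f : ℝ → ℝ) (n : ℤ) :
    fourierCoeff (fun t => (f (ofAddCircle t) : ℂ)) (-n) =
      starRingEnd ℂ (fourierCoeff (fun t => (f (ofAddCircle t) : ℂ)) n) := by
  simp only [fourierCoeff_comp_ofAddCircle, ← integral_conj, map_mul, Complex.conj_ofReal,
    fourier_neg]

lemma integrable_fourier_toAddCircle_mul (n : ℤ) {f : ℝ → ℝ} (hf : Integrable f ν) :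
    Integrable (fun x => (fourier n (toAddCircle x) : ℂ) * f x) ν :=
  hf.ofReal.bdd_mul (c := 1)
    (((fourier n).continuous.comp continuous_toAddCircle).aestronglyMeasurable)
    (.of_forall fun _ => (norm_fourier_apply _ _).le)

lemma casCoeff_eq_re_sub_im {f : ℝ → ℝ} (hf : Integrable f ν) (n : ℤ) :
    casCoeff f n = (fourierCoeff (fun t => (f (ofAddCircle t) : ℂ)) n).re -
      (fourierCoeff (fun t => (f (ofAddCircle t) : ℂ)) n).im := by
  have h := (Complex.reCLM - Complex.imCLM).integral_comp_comm
    (integrable_fourier_toAddCircle_mul (-n) hf)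
  rw [← fourierCoeff_comp_ofAddCircle] at h
  refine Eq.trans (integral_congr_ae (.of_forall fun x => ?_)) h
  have harg : 2 * ((-n : ℤ) : ℝ) * Real.arctan x = -(2 * n * Real.arctan x) := by
    push_cast
    ring
  simp only [cas, fourier_toAddCircle, sub_apply, Complex.reCLM_apply,
    Complex.imCLM_apply, Complex.re_mul_ofReal, Complex.im_mul_ofReal,
    Complex.exp_ofReal_mul_I_re, Complex.exp_ofReal_mul_I_im, harg, Real.cos_neg, Real.sin_neg]
  ring

lemma enorm_fourierCoeff_sq_add {f : ℝ → ℝ} (hf : Integrable f ν) (n : ℤ) :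
    ‖fourierCoeff (fun t => (f (ofAddCircle t) : ℂ)) n‖ₑ ^ 2 +
        ‖fourierCoeff (fun t => (f (ofAddCircle t) : ℂ)) (-n)‖ₑ ^ 2 =
      ENNReal.ofReal (casCoeff f n ^ 2) + ENNReal.ofReal (casCoeff f (-n) ^ 2) := by
  rw [casCoeff_eq_re_sub_im hf, casCoeff_eq_re_sub_im hf, fourierCoeff_comp_ofAddCircle_neg,
    RCLike.enorm_conj, ← enorm_norm, enorm_sq_eq_ofReal, Complex.sq_norm, Complex.normSq_apply,
    Complex.conj_re, Complex.conj_im,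
    ← ENNReal.ofReal_add (add_nonneg (mul_self_nonneg _) (mul_self_nonneg _))
      (add_nonneg (mul_self_nonneg _) (mul_self_nonneg _)),
    ← ENNReal.ofReal_add (sq_nonneg _) (sq_nonneg _)]
  congr 1
  ring

lemma tsum_mul_enorm_fourierCoeff_sq {f : ℝ → ℝ} (hf : Integrable f ν) {w : ℤ → ℝ≥0∞}
    (hw : w.Even) :
    ∑' n, w n * ‖fourierCoeff (fun t => (f (ofAddCircle t) : ℂ)) n‖ₑ ^ 2 =
      ∑' n, w n * ENNReal.ofReal (casCoeff f n ^ 2) := by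
  have hpair (a : ℤ → ℝ≥0∞) : 2 * ∑' n, w n * a n = ∑' n, w n * (a n + a (-n)) := by
    simp only [mul_add, ENNReal.tsum_add, two_mul]
    congr 1
    rw [← (Equiv.neg ℤ).tsum_eq]
    simp only [Equiv.neg_apply, hw _]
  rw [← ENNReal.mul_right_inj two_ne_zero ENNReal.ofNat_ne_top, hpair, hpair]
  simp only [enorm_fourierCoeff_sq_add hf]

lemma memLp_comp_ofAddCircle {f : ℝ → ℝ} (hf : MemLp f 2 ν) :
    MemLp (fun t => (f (ofAddCircle t) : ℂ)) 2 haarAddCircle := by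
  refine MemLp.ofReal ?_
  rw [← measurePreserving_toAddCircle.map_eq, measurableEmbedding_toAddCircle.memLp_map_measure_iff]
  simpa only [Function.comp_def, ofAddCircle_toAddCircle] using hf

lemma hasSum_casCoeff_sq {f : ℝ → ℝ} (hf : MemLp f 2 ν) :
    HasSum (fun n => casCoeff f n ^ 2) (∫ x, f x ^ 2 ∂ν) := by
  refine hasSum_of_lintegral_enorm_sq_eq_tsum hf (fun n => sq_nonneg _) ?_
  have h := lintegral_enorm_sq_eq_tsum_fourierCoeff (memLp_comp_ofAddCircle hf)
  rw [← measurePreserving_toAddCircle.lintegral_comp_emb measurableEmbedding_toAddCircle] at h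
  have hcas := tsum_mul_enorm_fourierCoeff_sq (hf.integrable one_le_two) (w := 1) fun _ => rfl
  simp only [Pi.one_apply, one_mul] at hcas
  simpa only [ofAddCircle_toAddCircle, enorm_ofReal, hcas] using h

lemma hasSum_casCoeff_mul {f g : ℝ → ℝ} (hf : MemLp f 2 ν) (hg : MemLp g 2 ν) :
    HasSum (fun n => casCoeff f n * casCoeff g n) (∫ x, f x * g x ∂ν) := by
  have hfi := hf.integrable one_le_two
  have hgi := hg.integrable one_le_two
  have hpolar (n : ℤ) : casCoeff f n * casCoeff g n =
      1 / 4 * (casCoeff (f + g) n ^ 2 - casCoeff (f - g) n ^ 2) := by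
    rw [casCoeff_add hfi hgi, casCoeff_sub hfi hgi, Pi.add_apply, Pi.sub_apply]
    ring
  simp only [integral_mul_eq_polarization hf hg, hpolar]
  exact ((hasSum_casCoeff_sq (hf.add hg)).sub (hasSum_casCoeff_sq (hf.sub hg))).mul_left (1 / 4)

lemma ae_eq_zero_of_casCoeff_eq_zero {f : ℝ → ℝ} (hf : MemLp f 2 ν)
    (h : ∀ n, casCoeff f n = 0) : f =ᵐ[volume] 0 := by
  have hsum := hasSum_casCoeff_sq hf
  simp only [h, ne_eq, OfNat.ofNat_ne_zero, not_false_eq_true, zero_pow] at hsum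
  have hint := (integral_eq_zero_iff_of_nonneg (fun _ => sq_nonneg _) hf.integrable_sq).1
    (hsum.unique hasSum_zero)
  exact absolutelyContinuous_cauchyMeasure.ae_eq
    (hint.mono fun x hx => pow_eq_zero_iff two_ne_zero |>.1 hx)

lemma integral_fourier_toAddCircle (n : ℤ) :
    ∫ x, (fourier n (toAddCircle x) : ℂ) ∂ν = if n = 0 then 1 else 0 := by
  have h := congrFun (fourierCoeff_fourier (T := 1) n) 0
  simp only [fourierCoeff, neg_zero, fourier_zero, one_smul] at h
  rw [measurePreserving_toAddCircle.integral_comp measurableEmbedding_toAddCircle, h,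
    Pi.single_apply]
  simp only [eq_comm]

lemma integrable_fourier_toAddCircle (n : ℤ) :
    Integrable (fun x => (fourier n (toAddCircle x) : ℂ)) ν := by
  simpa only [Complex.ofReal_one, mul_one] using
    integrable_fourier_toAddCircle_mul n (integrable_const 1)

lemma integral_cos_arctan (n : ℤ) :
    ∫ x, Real.cos (2 * n * Real.arctan x) ∂ν = if n = 0 then 1 else 0 := by
  have h := Complex.reCLM.integral_comp_comm (integrable_fourier_toAddCircle n)
  rw [integral_fourier_toAddCircle, Complex.reCLM_apply, apply_ite Complex.re, Complex.one_re,
    Complex.zero_re] at h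
  simpa only [fourier_toAddCircle, Complex.reCLM_apply, Complex.exp_ofReal_mul_I_re] using h

lemma integral_sin_arctan (n : ℤ) : ∫ x, Real.sin (2 * n * Real.arctan x) ∂ν = 0 := by
  have h := Complex.imCLM.integral_comp_comm (integrable_fourier_toAddCircle n)
  rw [integral_fourier_toAddCircle, Complex.imCLM_apply, apply_ite Complex.im, Complex.one_im,
    Complex.zero_im, ite_self] at h
  simpa only [fourier_toAddCircle, Complex.imCLM_apply, Complex.exp_ofReal_mul_I_im] using h

lemma cas_mul_cas (k n : ℤ) (x : ℝ) :
    cas k x * cas n x = Real.cos (2 * (k - n : ℤ) * Real.arctan x) +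
      Real.sin (2 * (k + n : ℤ) * Real.arctan x) := by
  unfold cas
  push_cast
  simp only [mul_sub, mul_add, sub_mul, add_mul, Real.cos_sub, Real.sin_add]
  ring

lemma casCoeff_cas (k : ℤ) : casCoeff (cas k) = Pi.single k 1 := by
  ext n
  simp only [casCoeff, cas_mul_cas]
  rw [integral_add, integral_cos_arctan, integral_sin_arctan, add_zero, Pi.single_apply]
  · simp only [sub_eq_zero, eq_comm]
  · exact .of_bound (by fun_prop) 1 (.of_forall fun x => Real.abs_cos_le_one _)
  · exact .of_bound (by fun_prop) 1 (.of_forall fun x => Real.abs_sin_le_one _)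

/-! ### The energy space -/

/-- The difference quotient `(x, y) ↦ (f x - f y) / (x - y)`, whose square integral is the Gagliardo
energy. -/
def diffQuot : (ℝ → ℝ) →ₗ[ℝ] ℝ × ℝ → ℝ where
  toFun f p := (f p.1 - f p.2) / (p.1 - p.2)
  map_add' f g := by
    ext p
    simp only [Pi.add_apply]
    ring
  map_smul' c f := by
    ext p
    simp only [Pi.smul_apply, smul_eq_mul, RingHom.id_apply]
    ring

lemma diffQuot_apply (f : ℝ → ℝ) (p : ℝ × ℝ) : diffQuot f p = (f p.1 - f p.2) / (p.1 - p.2) := rfl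

lemma aestronglyMeasurable_of_cauchyMeasure {f : ℝ → ℝ} (hf : AEStronglyMeasurable f ν) :
    AEStronglyMeasurable f volume :=
  hf.mono_ac absolutelyContinuous_cauchyMeasure

lemma aestronglyMeasurable_diffQuot {f : ℝ → ℝ} (hf : AEStronglyMeasurable f volume) :
    AEStronglyMeasurable (diffQuot f) volume :=
  ((hf.comp_fst.sub hf.comp_snd).aemeasurable.div (by fun_prop)).aestronglyMeasurable

lemma memHdotHalf_iff {f : ℝ → ℝ} :
    MemHdotHalf f ↔ Integrable f ν ∧ MemLp (diffQuot f) 2 := by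
  rw [MemHdotHalf, ← integrable_cauchyMeasure_iff]
  refine and_congr_right fun hf => ?_
  rw [memLp_two_iff_integrable_sq
    (aestronglyMeasurable_diffQuot (aestronglyMeasurable_of_cauchyMeasure hf.1))]
  simp only [diffQuot_apply, div_pow]

lemma MemHdotHalf.integrable {f : ℝ → ℝ} (hf : MemHdotHalf f) : Integrable f ν :=
  (memHdotHalf_iff.1 hf).1

lemma MemHdotHalf.memLp_diffQuot {f : ℝ → ℝ} (hf : MemHdotHalf f) : MemLp (diffQuot f) 2 :=
  (memHdotHalf_iff.1 hf).2

/-- `Ḣ^{1/2}(ℝ)` as a subspace of the space of all functions. -/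
def energySpace : Submodule ℝ (ℝ → ℝ) where
  carrier := {f | MemHdotHalf f}
  add_mem' hf hg := memHdotHalf_iff.2 ⟨hf.integrable.add hg.integrable, by
    rw [map_add]
    exact hf.memLp_diffQuot.add hg.memLp_diffQuot⟩
  zero_mem' := memHdotHalf_iff.2 ⟨integrable_zero _ _ _, by
    rw [map_zero]
    exact .zero⟩
  smul_mem' c _ hf := memHdotHalf_iff.2 ⟨hf.integrable.smul c, by
    rw [map_smul]
    exact hf.memLp_diffQuot.const_smul c⟩

lemma MemHdotHalf.add {f g : ℝ → ℝ} (hf : MemHdotHalf f) (hg : MemHdotHalf g) :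
    MemHdotHalf (f + g) :=
  energySpace.add_mem hf hg

lemma MemHdotHalf.sub {f g : ℝ → ℝ} (hf : MemHdotHalf f) (hg : MemHdotHalf g) :
    MemHdotHalf (f - g) :=
  energySpace.sub_mem hf hg

lemma MemHdotHalf.smul {f : ℝ → ℝ} (hf : MemHdotHalf f) (c : ℝ) : MemHdotHalf (c • f) :=
  energySpace.smul_mem c hf

lemma lintegral_gagliardo_line {f : ℝ → ℝ} (hf : AEStronglyMeasurable f ν) :
    ∫⁻ p, ‖diffQuot f p‖ₑ ^ 2 = ENNReal.ofReal (4 * Real.pi ^ 2) *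
      ∫⁻ p : ℝ × ℝ, ‖((f p.1 : ℂ) - f p.2) /
        (fourier 1 (toAddCircle p.1) - fourier 1 (toAddCircle p.2))‖ₑ ^ 2 ∂(Measure.prod ν ν) := by
  have hcont : Continuous fun x => (fourier 1 (toAddCircle x) : ℂ) :=
    (fourier 1).continuous.comp continuous_toAddCircle
  have hf' := aestronglyMeasurable_of_cauchyMeasure hf
  have hmeas : AEMeasurable (fun p : ℝ × ℝ => ‖((f p.1 : ℂ) - f p.2) /
      (fourier 1 (toAddCircle p.1) - fourier 1 (toAddCircle p.2))‖ₑ ^ 2) (volume.prod volume) := by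
    have hf₁ : AEMeasurable (fun p : ℝ × ℝ => f p.1) (volume.prod volume) :=
      hf'.comp_fst.aemeasurable
    have hf₂ : AEMeasurable (fun p : ℝ × ℝ => f p.2) (volume.prod volume) :=
      hf'.comp_snd.aemeasurable
    have hden := ((hcont.comp continuous_fst).sub (hcont.comp continuous_snd)).measurable
    exact ((hf₁.complex_ofReal.sub hf₂.complex_ofReal).div hden.aemeasurable).enorm.pow_const 2
  rw [cauchyMeasure_zero_one, prod_withDensity (by fun_prop) (by fun_prop),
    lintegral_withDensity_eq_lintegral_mul₀ (by fun_prop) hmeas,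
    ← lintegral_const_mul'' _ (.mul (by fun_prop) hmeas)]
  refine lintegral_congr fun p => ?_
  rw [Pi.mul_apply, ← Complex.ofReal_sub, ← enorm_norm (_ / _), enorm_sq_eq_ofReal,
    enorm_sq_eq_ofReal, norm_div, Complex.norm_real, Real.norm_eq_abs, div_pow, sq_abs,
    norm_fourier_one_sub_sq, diffQuot_apply, ← ENNReal.ofReal_mul (by positivity),
    ← ENNReal.ofReal_mul (by positivity), ← ENNReal.ofReal_mul (by positivity)]
  congr 1
  rcases eq_or_ne p.1 p.2 with h | h
  · simp only [h, sub_self, zero_div, ne_eq, OfNat.ofNat_ne_zero, not_false_eq_true, zero_pow,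
      mul_zero]
  · have := sub_ne_zero.2 h
    field_simp

lemma lintegral_diffQuot_sq {f : ℝ → ℝ} (hf : MemLp f 2 ν) :
    ∫⁻ p, ‖diffQuot f p‖ₑ ^ 2 =
      ∑' n : ℤ, ENNReal.ofReal (4 * Real.pi ^ 2 * (|(n : ℝ)| * casCoeff f n ^ 2)) := by
  have hcircle := lintegral_gagliardo_circle (memLp_comp_ofAddCircle hf)
  rw [← (measurePreserving_toAddCircle.prod measurePreserving_toAddCircle).lintegral_comp_emb
    (measurableEmbedding_toAddCircle.prodMap measurableEmbedding_toAddCircle),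
    tsum_mul_enorm_fourierCoeff_sq (hf.integrable one_le_two) (w := fun n => n.natAbs)
      fun n => by simp only [Int.natAbs_neg]] at hcircle
  simp only [Prod.map_fst, Prod.map_snd, ofAddCircle_toAddCircle] at hcircle
  rw [lintegral_gagliardo_line hf.1, hcircle, ← ENNReal.tsum_mul_left]
  congr with n
  rw [ENNReal.ofReal_mul (p := 4 * Real.pi ^ 2) (by positivity),
    ENNReal.ofReal_mul (abs_nonneg _), ← Int.cast_abs,
    Int.abs_eq_natAbs, Int.cast_natCast, ENNReal.ofReal_natCast]

lemma memLp_two_of_memLp_sub {α E : Type*} [MeasurableSpace α] [NormedAddCommGroup E]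
    {μ : Measure α} [IsFiniteMeasure μ] [NeZero μ] {f : α → E} (hf : AEStronglyMeasurable f μ)
    (h : MemLp (fun p : α × α => f p.1 - f p.2) 2 (μ.prod μ)) : MemLp f 2 μ := by
  obtain ⟨y, hy⟩ := ((memLp_two_iff_integrable_sq_norm h.1).1 h).prod_left_ae.exists
  have hsub : MemLp (fun x => f x - f y) 2 μ :=
    (memLp_two_iff_integrable_sq_norm (hf.sub aestronglyMeasurable_const)).2 hy
  simpa only [Pi.add_def, sub_add_cancel] using hsub.add (memLp_const (f y))

lemma enorm_sub_le_two_mul_enorm_div {T : ℝ} [Fact (0 < T)] (F : AddCircle T → ℂ)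
    (s t : AddCircle T) : ‖F s - F t‖ₑ ≤ 2 * ‖(F s - F t) / (fourier 1 s - fourier 1 t)‖ₑ := by
  rcases eq_or_ne s t with rfl | hst
  · simp only [sub_self, enorm_zero, zero_le]
  have hne : (fourier 1 s - fourier 1 t : ℂ) ≠ 0 := by
    rw [sub_ne_zero, fourier_one, fourier_one]
    exact Circle.coe_injective.ne ((injective_toCircle (Fact.out : 0 < T).ne').ne hst)
  calc ‖F s - F t‖ₑ
      = ‖(fourier 1 s - fourier 1 t : ℂ)‖ₑ * ‖(F s - F t) / (fourier 1 s - fourier 1 t)‖ₑ := by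
        rw [← enorm_mul, mul_div_cancel₀ _ hne]
    _ ≤ 2 * ‖(F s - F t) / (fourier 1 s - fourier 1 t)‖ₑ := by
        gcongr
        refine enorm_sub_le.trans_eq ?_
        rw [← ofReal_norm, ← ofReal_norm, norm_fourier_apply, norm_fourier_apply,
          ENNReal.ofReal_one, one_add_one_eq_two]

lemma MemHdotHalf.memLp {f : ℝ → ℝ} (hf : MemHdotHalf f) : MemLp f 2 ν := by
  have hmeas := hf.integrable.1
  have henergy := (memLp_two_iff_lintegral_enorm_sq hf.memLp_diffQuot.1).1 hf.memLp_diffQuot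
  rw [lintegral_gagliardo_line hmeas] at henergy
  have hle (p : ℝ × ℝ) : ‖f p.1 - f p.2‖ₑ ^ 2 ≤ 2 ^ 2 * ‖((f p.1 : ℂ) - f p.2) /
      (fourier 1 (toAddCircle p.1) - fourier 1 (toAddCircle p.2))‖ₑ ^ 2 := by
    have h := enorm_sub_le_two_mul_enorm_div (fun t => (f (ofAddCircle t) : ℂ))
      (toAddCircle p.1) (toAddCircle p.2)
    simp only [ofAddCircle_toAddCircle] at h
    rw [← mul_pow, ← enorm_ofReal, Complex.ofReal_sub]
    gcongr
  have hmeas₂ : AEStronglyMeasurable (fun p : ℝ × ℝ => f p.1 - f p.2) (Measure.prod ν ν) :=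
    hmeas.comp_fst.sub hmeas.comp_snd
  refine memLp_two_of_memLp_sub hmeas ((memLp_two_iff_lintegral_enorm_sq hmeas₂).2 ?_)
  refine (lintegral_mono hle).trans_lt ?_
  rw [lintegral_const_mul' _ _ (by simp)]
  exact ENNReal.mul_lt_top (by simp) (ENNReal.lt_top_of_mul_ne_top_right henergy.ne
    (ENNReal.ofReal_pos.2 (by positivity)).ne')

lemma memHdotHalf_of_summable {f : ℝ → ℝ} (hf : MemLp f 2 ν)
    (hs : Summable fun n : ℤ => |(n : ℝ)| * casCoeff f n ^ 2) : MemHdotHalf f := by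
  have hmeas := aestronglyMeasurable_diffQuot (aestronglyMeasurable_of_cauchyMeasure hf.1)
  refine memHdotHalf_iff.2 ⟨hf.integrable one_le_two,
    (memLp_two_iff_lintegral_enorm_sq hmeas).2 ?_⟩
  rw [lintegral_diffQuot_sq hf,
    ← ENNReal.ofReal_tsum_of_nonneg (fun n => by positivity) (hs.mul_left _)]
  exact ENNReal.ofReal_lt_top

lemma memHdotHalf_cas (n : ℤ) : MemHdotHalf (cas n) := by
  refine memHdotHalf_of_summable (memLp_cas n)
    (summable_of_ne_finset_zero (s := {n}) fun k hk => ?_)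
  rw [casCoeff_cas, Pi.single_eq_of_ne (by simpa using hk), zero_pow two_ne_zero, mul_zero]

lemma halfLapForm_eq_integral_diffQuot (f g : ℝ → ℝ) :
    halfLapForm f g = 1 / (2 * Real.pi) * ∫ p, diffQuot f p * diffQuot g p := by
  simp only [halfLapForm, diffQuot_apply, div_mul_div_comm, ← sq]

lemma hasSum_hdotNormSq {f : ℝ → ℝ} (hf : MemHdotHalf f) :
    HasSum (fun n : ℤ => 2 * Real.pi * (|(n : ℝ)| * casCoeff f n ^ 2)) (hdotNormSq f) := by
  have h := (hasSum_of_lintegral_enorm_sq_eq_tsum hf.memLp_diffQuot (fun n => by positivity)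
    (lintegral_diffQuot_sq hf.memLp)).mul_left (1 / (2 * Real.pi))
  rw [hdotNormSq, halfLapForm_eq_integral_diffQuot]
  simp only [← sq]
  refine h.congr_fun fun n => ?_
  field_simp
  ring

lemma hasSum_halfLapForm {f g : ℝ → ℝ} (hf : MemHdotHalf f) (hg : MemHdotHalf g) :
    HasSum (fun n : ℤ => 2 * Real.pi * (|(n : ℝ)| * (casCoeff f n * casCoeff g n)))
      (halfLapForm f g) := by
  have hpolar : halfLapForm f g = 1 / 4 * (hdotNormSq (f + g) - hdotNormSq (f - g)) := by
    simp only [hdotNormSq, halfLapForm_eq_integral_diffQuot, ← sq, map_add, map_sub,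
      integral_mul_eq_polarization hf.memLp_diffQuot hg.memLp_diffQuot]
    ring
  have hcoeff (n : ℤ) : 2 * Real.pi * (|(n : ℝ)| * (casCoeff f n * casCoeff g n)) =
      1 / 4 * (2 * Real.pi * (|(n : ℝ)| * casCoeff (f + g) n ^ 2) -
        2 * Real.pi * (|(n : ℝ)| * casCoeff (f - g) n ^ 2)) := by
    rw [casCoeff_add hf.integrable hg.integrable, casCoeff_sub hf.integrable hg.integrable,
      Pi.add_apply, Pi.sub_apply]
    ring
  simp only [hpolar, hcoeff]
  exact ((hasSum_hdotNormSq (hf.add hg)).sub (hasSum_hdotNormSq (hf.sub hg))).mul_left (1 / 4)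

lemma hasSum_LplusForm (m : ℕ) {f g : ℝ → ℝ} (hf : MemHdotHalf f) (hg : MemHdotHalf g) :
    HasSum (fun n : ℤ => 2 * Real.pi * ((|(n : ℝ)| - m) * (casCoeff f n * casCoeff g n)))
      (LplusForm m f g) := by
  rw [LplusForm, integral_div_one_add_sq_mul]
  refine ((hasSum_halfLapForm hf hg).sub ((hasSum_casCoeff_mul hf.memLp hg.memLp).mul_left
    (2 * (m : ℝ) * Real.pi))).congr_fun fun n => ?_
  ring

/-! ### The operator `R` -/

lemma norm_sum_exp_mul_I_sq {ι : Type*} (s : Finset ι) (α : ι → ℝ) :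
    ‖∑ j ∈ s, Complex.exp (α j * Complex.I)‖ ^ 2 = ∑ p ∈ s ×ˢ s, Real.cos (α p.1 - α p.2) := by
  simp only [← Complex.normSq_eq_norm_sq, Complex.normSq_apply, Complex.re_sum, Complex.im_sum,
    Complex.exp_ofReal_mul_I_re, Complex.exp_ofReal_mul_I_im, Finset.sum_mul_sum,
    ← Finset.sum_product', ← Finset.sum_add_distrib, Real.cos_sub]

lemma norm_pow_sub_pow_of_norm_eq_one (m : ℕ) (z : ℂ) {w : ℂ} (hw : ‖w‖ = 1) :
    ‖z ^ m - w ^ m‖ = ‖∑ j ∈ Finset.range m, (z / w) ^ j‖ * ‖z - w‖ := by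
  have hw₀ : w ≠ 0 := norm_ne_zero_iff.1 (by rw [hw]; exact one_ne_zero)
  calc ‖z ^ m - w ^ m‖ = ‖(z / w) ^ m - 1‖ := by
        rw [div_pow, div_sub_one (pow_ne_zero m hw₀), norm_div, norm_pow w, hw, one_pow, div_one]
    _ = ‖∑ j ∈ Finset.range m, (z / w) ^ j‖ * ‖z - w‖ := by
        rw [← geom_sum_mul, norm_mul, div_sub_one hw₀, norm_div (z - w), hw, div_one]

lemma Qmap_eq (m : ℕ) (x : ℝ) : Qmap m x = (-Complex.I * fourier 1 (toAddCircle x)) ^ m := by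
  have hne := one_sub_mul_I_ne_zero x
  have hne' : (x : ℂ) + Complex.I ≠ 0 := fun h => by simpa using congrArg Complex.im h
  rw [Qmap, fourier_one_toAddCircle]
  congr 1
  rw [mul_div_assoc', mul_div_assoc', div_eq_div_iff hne' hne]
  linear_combination (2 * x * Complex.I) * Complex.I_sq

lemma sum_cas_mul_cas (m : ℕ) (x y : ℝ) :
    ∑ p ∈ Finset.range m ×ˢ Finset.range m,
        cas ((p.1 : ℤ) - p.2) x * cas ((p.1 : ℤ) - p.2) y =
      ∑ p ∈ Finset.range m ×ˢ Finset.range m,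
        Real.cos (2 * ((p.1 : ℝ) - p.2) * (Real.arctan x - Real.arctan y)) := by
  have hodd : ∑ p ∈ Finset.range m ×ˢ Finset.range m,
      Real.sin (2 * ((p.1 : ℝ) - p.2) * (Real.arctan x + Real.arctan y)) = 0 := by
    refine self_eq_neg.1 ?_
    rw [← Finset.sum_neg_distrib]
    refine Finset.sum_equiv (Equiv.prodComm ℕ ℕ) (by simp [and_comm]) fun p _ => ?_
    rw [← Real.sin_neg, Equiv.prodComm_apply, Prod.fst_swap, Prod.snd_swap]
    ring_nf
  rw [← add_zero (∑ p ∈ _, Real.cos _), ← hodd, ← Finset.sum_add_distrib]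
  refine Finset.sum_congr rfl fun p _ => ?_
  rw [mul_add, Real.sin_add, mul_sub, Real.cos_sub]
  simp only [cas, Int.cast_sub, Int.cast_natCast]
  ring

lemma norm_Qmap_sub_sq (m : ℕ) (x y : ℝ) : ‖Qmap m x - Qmap m y‖ ^ 2 =
    4 * (x - y) ^ 2 / ((1 + x ^ 2) * (1 + y ^ 2)) * ∑ p ∈ Finset.range m ×ˢ Finset.range m,
      cas ((p.1 : ℤ) - p.2) x * cas ((p.1 : ℤ) - p.2) y := by
  have hpow (j : ℕ) : ((fourier 1 (toAddCircle x) : ℂ) / fourier 1 (toAddCircle y)) ^ j =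
      Complex.exp ((2 * j * (Real.arctan x - Real.arctan y) : ℝ) * Complex.I) := by
    rw [fourier_toAddCircle, fourier_toAddCircle, ← Complex.exp_sub, ← Complex.exp_nat_mul]
    push_cast
    ring_nf
  rw [Qmap_eq, Qmap_eq, mul_pow, mul_pow, ← mul_sub, norm_mul, norm_pow, norm_neg, Complex.norm_I,
    one_pow, one_mul, norm_pow_sub_pow_of_norm_eq_one _ _ (norm_fourier_apply _ _), mul_pow,
    norm_fourier_one_sub_sq, mul_comm, sum_cas_mul_cas]
  simp only [hpow, norm_sum_exp_mul_I_sq, ← sub_mul, ← mul_sub]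

section Rop

variable (m : ℕ) {f : ℝ → ℝ}

lemma ae_norm_Qmap_sub_sq_div_mul_eq (f : ℝ → ℝ) (x : ℝ) :
    (fun y => ‖Qmap m x - Qmap m y‖ ^ 2 / (x - y) ^ 2 * f y) =ᵐ[volume]
      fun y => 4 / (1 + x ^ 2) / (1 + y ^ 2) * ∑ p ∈ Finset.range m ×ˢ Finset.range m,
        cas ((p.1 : ℤ) - p.2) x * (f y * cas ((p.1 : ℤ) - p.2) y) := by
  filter_upwards [Measure.ae_ne volume x] with y hy
  have hxy := sub_ne_zero.2 hy.symm
  rw [norm_Qmap_sub_sq]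
  simp only [mul_left_comm _ (f y), ← Finset.mul_sum]
  field_simp

lemma integrable_norm_Qmap_sub_sq_div_mul (hf : Integrable f ν) (x : ℝ) :
    Integrable fun y => ‖Qmap m x - Qmap m y‖ ^ 2 / (x - y) ^ 2 * f y :=
  (integrable_div_one_add_sq_mul (integrable_finsetSum _ fun _ _ =>
    (integrable_mul_cas hf _).const_mul _) _).congr (ae_norm_Qmap_sub_sq_div_mul_eq m f x).symm

lemma Rop_eq (hf : Integrable f ν) (x : ℝ) :
    Rop m f x = 2 / (1 + x ^ 2) * ∑ p ∈ Finset.range m ×ˢ Finset.range m,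
      casCoeff f ((p.1 : ℤ) - p.2) * cas ((p.1 : ℤ) - p.2) x := by
  rw [Rop, integral_congr_ae (ae_norm_Qmap_sub_sq_div_mul_eq m f x), integral_div_one_add_sq_mul,
    integral_finsetSum _ fun _ _ => (integrable_mul_cas hf _).const_mul _]
  simp only [mul_comm (cas _ x), integral_mul_const, casCoeff]
  field_simp
  norm_num

lemma mul_Rop_eq (hf : Integrable f ν) (x : ℝ) :
    f x * Rop m f x = 2 / (1 + x ^ 2) * ∑ p ∈ Finset.range m ×ˢ Finset.range m,
      casCoeff f ((p.1 : ℤ) - p.2) * (f x * cas ((p.1 : ℤ) - p.2) x) := by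
  rw [Rop_eq m hf]
  simp only [mul_left_comm _ (f x), ← Finset.mul_sum]

lemma integrable_mul_Rop (hf : Integrable f ν) : Integrable fun x => f x * Rop m f x := by
  simp only [mul_Rop_eq m hf]
  exact integrable_div_one_add_sq_mul (integrable_finsetSum _ fun _ _ =>
    (integrable_mul_cas hf _).const_mul _) _

lemma integral_mul_Rop (hf : Integrable f ν) :
    ∫ x, f x * Rop m f x = 2 * Real.pi * ∑ p ∈ Finset.range m ×ˢ Finset.range m,
      casCoeff f ((p.1 : ℤ) - p.2) ^ 2 := by
  simp only [mul_Rop_eq m hf]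
  rw [integral_div_one_add_sq_mul,
    integral_finsetSum _ fun _ _ => (integrable_mul_cas hf _).const_mul _]
  simp only [integral_const_mul, sq, casCoeff]

lemma LplusForm_le_LminusForm (hf : Integrable f ν) : LplusForm m f f ≤ LminusForm m f f := by
  rw [LminusForm, integral_mul_Rop m hf]
  exact le_add_of_nonneg_right (by positivity)

end Rop

/-! ### The weight -/

/-- The weight `2 / (1 + x²)`, which is `1 + cos θ` in the variable `θ = 2 arctan x`. -/
def weight (x : ℝ) : ℝ := 2 / (1 + x ^ 2)

/-- Multiplication by the weight `1 + cos θ` in terms of Hartley coefficients. -/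
def weightOp : (ℤ → ℝ) →ₗ[ℝ] ℤ → ℝ where
  toFun b n := b n + 1 / 2 * b (n - 1) + 1 / 2 * b (n + 1)
  map_add' b c := by
    ext n
    simp only [Pi.add_apply]
    ring
  map_smul' r b := by
    ext n
    simp only [Pi.smul_apply, smul_eq_mul, RingHom.id_apply]
    ring

lemma weightOp_apply (b : ℤ → ℝ) (n : ℤ) :
    weightOp b n = b n + 1 / 2 * b (n - 1) + 1 / 2 * b (n + 1) := rfl

lemma weight_pos (x : ℝ) : 0 < weight x := by unfold weight; positivity

@[fun_prop]
lemma continuous_weight : Continuous weight := by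
  unfold weight
  fun_prop (disch := intro x; positivity)

lemma weight_mul_cas (n : ℤ) :
    weight * cas n = cas n + (1 / 2 : ℝ) • cas (n - 1) + (1 / 2 : ℝ) • cas (n + 1) := by
  ext x
  have hweight : weight x = 1 + Real.cos (2 * Real.arctan x) := by
    rw [Real.cos_two_mul, Real.cos_sq_arctan, weight]
    ring
  simp only [Pi.mul_apply, Pi.add_apply, Pi.smul_apply, smul_eq_mul, hweight, cas]
  push_cast
  simp only [mul_sub, mul_add, sub_mul, add_mul, mul_one, Real.cos_sub, Real.cos_add, Real.sin_sub,
    Real.sin_add]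
  ring

lemma casCoeff_weight_mul {f : ℝ → ℝ} (hf : Integrable f ν) :
    casCoeff (weight * f) = weightOp (casCoeff f) := by
  ext n
  have hmul (x : ℝ) : (weight * f) x * cas n x = f x * cas n x + 1 / 2 * (f x * cas (n - 1) x) +
      1 / 2 * (f x * cas (n + 1) x) := by
    have h := congrFun (weight_mul_cas n) x
    simp only [Pi.mul_apply, Pi.add_apply, Pi.smul_apply, smul_eq_mul] at h ⊢
    linear_combination f x * h
  have hint := integrable_mul_cas hf
  simp only [casCoeff, weightOp_apply, hmul]
  rw [integral_add, integral_add (hint n) ((hint _).const_mul _), integral_const_mul,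
    integral_const_mul]
  · exact (hint n).add ((hint _).const_mul _)
  · exact (hint _).const_mul _

lemma memHdotHalf_weight_mul_cas (n : ℤ) : MemHdotHalf (weight * cas n) := by
  rw [weight_mul_cas]
  exact ((memHdotHalf_cas n).add ((memHdotHalf_cas _).smul _)).add ((memHdotHalf_cas _).smul _)

/-! ### Square integrability on the line -/

lemma memLp_two_of_sq_le_div {f : ℝ → ℝ} (hf : AEStronglyMeasurable f volume) {C : ℝ}
    (h : ∀ x, f x ^ 2 ≤ C / (1 + x ^ 2)) : MemLp f 2 := by
  rw [memLp_two_iff_integrable_sq hf]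
  refine (integrable_inv_one_add_sq.const_mul C).mono' (hf.pow 2) (.of_forall fun x => ?_)
  rw [Real.norm_of_nonneg (sq_nonneg _), ← div_eq_mul_inv]
  exact h x

lemma memLp_weight : MemLp weight 2 := by
  refine memLp_two_of_sq_le_div (C := 4) (by fun_prop) fun x => ?_
  rw [weight, div_pow, div_le_div_iff₀ (by positivity) (by positivity)]
  nlinarith [sq_nonneg x]

lemma memLp_top_cas (n : ℤ) : MemLp (cas n) ⊤ :=
  memLp_top_of_bound (by fun_prop) 2 (.of_forall fun x => abs_cas_le n x)

lemma memLp_weight_mul_cas (n : ℤ) : MemLp (weight * cas n) 2 :=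
  (memLp_top_cas n).mul memLp_weight

lemma memLp_cas_add_cas_succ (n : ℤ) : MemLp (cas n + cas (n + 1)) 2 := by
  refine memLp_two_of_sq_le_div (C := 8) (by fun_prop) fun x => ?_
  set α := Real.arctan x with hα
  set β := (2 * n + 1) * α with hβ
  have hsum : (cas n + cas (n + 1)) x = 2 * Real.cos α * (Real.cos β + Real.sin β) := by
    simp only [Pi.add_apply, cas, ← hα]
    push_cast
    rw [show 2 * (n : ℝ) * α = β - α by rw [hβ]; ring,
      show 2 * ((n : ℝ) + 1) * α = β + α by rw [hβ]; ring,
      Real.cos_sub, Real.cos_add, Real.sin_sub, Real.sin_add]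
    ring
  have hβ' : (Real.cos β + Real.sin β) ^ 2 ≤ 2 := by
    nlinarith [Real.sin_sq_add_cos_sq β, sq_nonneg (Real.cos β - Real.sin β)]
  calc (cas n + cas (n + 1)) x ^ 2 = 4 / (1 + x ^ 2) * (Real.cos β + Real.sin β) ^ 2 := by
        rw [hsum, mul_pow, mul_pow, Real.cos_sq_arctan]
        ring
    _ ≤ 4 / (1 + x ^ 2) * 2 := by gcongr
    _ = 8 / (1 + x ^ 2) := by ring

lemma memLp_cas_sub_neg_one_zpow (n : ℤ) : MemLp (fun x => cas n x - (-1 : ℝ) ^ n) 2 := by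
  induction n using Int.induction_on with
  | zero => simp [cas]
  | succ n ih =>
    refine ((memLp_cas_add_cas_succ n).sub ih).congr_norm (by fun_prop) (.of_forall fun x => ?_)
    rw [zpow_add_one₀ (by norm_num), Pi.sub_apply, Pi.add_apply]
    ring_nf
  | pred n ih =>
    refine ((memLp_cas_add_cas_succ (-n - 1)).sub ih).congr_norm (by fun_prop)
      (.of_forall fun x => ?_)
    rw [zpow_sub_one₀ (by norm_num), Pi.sub_apply, Pi.add_apply, sub_add_cancel]
    ring_nf

lemma memLp_cas_sub_smul_cas (n k : ℤ) : MemLp (cas n - (-1 : ℝ) ^ (n - k) • cas k) 2 := by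
  convert (memLp_cas_sub_neg_one_zpow n).sub
    ((memLp_cas_sub_neg_one_zpow k).const_smul ((-1 : ℝ) ^ (n - k))) using 1
  ext x
  simp only [Pi.sub_apply, Pi.smul_apply, smul_eq_mul, mul_sub]
  rw [← zpow_add₀ (by norm_num), sub_add_cancel]
  ring

lemma memLp_cas_sub_cas_neg (n : ℤ) : MemLp (cas n - cas (-n)) 2 := by
  have h := memLp_cas_sub_smul_cas n (-n)
  rwa [sub_neg_eq_add, (Even.add_self n).neg_one_zpow, one_smul] at h

lemma cas_sq_add_cas_neg_sq (n : ℤ) (x : ℝ) : cas n x ^ 2 + cas (-n) x ^ 2 = 2 := by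
  simp only [cas, Int.cast_neg, mul_neg, neg_mul, Real.cos_neg, Real.sin_neg]
  linear_combination 2 * Real.sin_sq_add_cos_sq (2 * n * Real.arctan x)

-- The sum of the squares of `cas n ± cas (-n)` is the constant `4`.
lemma not_memLp_cas_add_cas_neg (n : ℤ) : ¬ MemLp (cas n + cas (-n)) 2 := by
  intro h
  have hconst : Integrable (fun _ : ℝ => (4 : ℝ)) := by
    refine (h.integrable_sq.add (memLp_cas_sub_cas_neg n).integrable_sq).congr
      (.of_forall fun x => ?_)
    simp only [Pi.add_apply, Pi.sub_apply]
    linear_combination 2 * cas_sq_add_cas_neg_sq n x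
  simp [integrable_const_iff, isFiniteMeasure_iff] at hconst

/-! ### Sobolev regularity -/

lemma memH1_of_differentiable {f : ℝ → ℝ} (hf : MemLp f 2) (hd : Differentiable ℝ f)
    (hf' : MemLp (deriv f) 2) : MemH1 f := by
  refine ⟨hf, deriv f, hf', fun η hη hc => ?_⟩
  have h₁ : MemLp η 2 := hη.continuous.memLp_of_hasCompactSupport hc
  have h₂ : MemLp (deriv η) 2 :=
    (hη.continuous_deriv (by simp)).memLp_of_hasCompactSupport hc.deriv
  exact integral_mul_deriv_eq_deriv_mul_of_integrable (fun x _ => (hd x).hasDerivAt)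
    (fun x _ => (hη.differentiable (by simp) x).hasDerivAt)
    (hf.integrable_mul h₂) (hf'.integrable_mul h₁) (hf.integrable_mul h₁)

/-- The differentiable functions with square integrable derivative. -/
def l2DerivSpace : Submodule ℝ (ℝ → ℝ) where
  carrier := {f | Differentiable ℝ f ∧ MemLp (deriv f) 2}
  add_mem' {f g} hf hg := ⟨hf.1.add hg.1, by
    rw [show deriv (f + g) = deriv f + deriv g from funext fun x => deriv_add (hf.1 x) (hg.1 x)]
    exact hf.2.add hg.2⟩
  zero_mem' := ⟨differentiable_const 0, by
    rw [show deriv (0 : ℝ → ℝ) = 0 from deriv_const' 0]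
    exact .zero⟩
  smul_mem' c f hf := ⟨hf.1.const_smul c, by
    rw [show deriv (c • f) = c • deriv f from funext fun x => deriv_const_smul c (hf.1 x)]
    exact hf.2.const_smul c⟩

lemma cas_mem_l2DerivSpace (n : ℤ) : cas n ∈ l2DerivSpace := by
  have hderiv (x : ℝ) : HasDerivAt (cas n) (n * (weight * cas (-n)) x) x := by
    have harg := (Real.hasDerivAt_arctan x).const_mul (2 * (n : ℝ))
    refine (harg.cos.add harg.sin).congr_deriv ?_
    simp only [Pi.mul_apply, weight, cas, Int.cast_neg, mul_neg, neg_mul, Real.cos_neg,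
      Real.sin_neg]
    ring
  refine ⟨fun x => (hderiv x).differentiableAt, ?_⟩
  rw [show deriv (cas n) = (n : ℝ) • (weight * cas (-n)) from funext fun x => (hderiv x).deriv]
  exact (memLp_weight_mul_cas (-n)).const_smul _

lemma weight_mul_cas_mem_l2DerivSpace (n : ℤ) : weight * cas n ∈ l2DerivSpace := by
  rw [weight_mul_cas]
  exact add_mem (add_mem (cas_mem_l2DerivSpace n) (Submodule.smul_mem _ _ (cas_mem_l2DerivSpace _)))
    (Submodule.smul_mem _ _ (cas_mem_l2DerivSpace _))

/-! ### Zero energy solutions -/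

lemma LplusForm_comm (m : ℕ) (f g : ℝ → ℝ) : LplusForm m f g = LplusForm m g f := by
  simp only [LplusForm, halfLapForm, mul_comm (f _ - f _), mul_comm (f _)]

lemma solvesLplus_zero_iff {m : ℕ} {u : ℝ → ℝ} :
    SolvesLplus m 0 u ↔ MemHdotHalf u ∧ ∀ n : ℤ, (|(n : ℝ)| - m) * casCoeff u n = 0 := by
  refine and_congr_right fun hu => ⟨fun h n => ?_, fun h η hη _ => ?_⟩
  · obtain rfl | hn := eq_or_ne n m
    · simp
    -- The multiplier `|n| - m` vanishes at the frequency `m`, so a multiple of `cas m` that makes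
    -- the test function square integrable is free.
    have hcas := memHdotHalf_cas n
    have hcas' := (memHdotHalf_cas m).smul ((-1 : ℝ) ^ (n - m))
    have hcoeff (k : ℤ) : casCoeff (cas n - (-1 : ℝ) ^ (n - m) • cas m) k =
        (Pi.single n 1 : ℤ → ℝ) k - (-1 : ℝ) ^ (n - m) * (Pi.single (m : ℤ) 1 : ℤ → ℝ) k := by
      rw [casCoeff_sub hcas.integrable hcas'.integrable, casCoeff_smul, casCoeff_cas, casCoeff_cas]
      rfl
    have hsum := hasSum_LplusForm m (hcas.sub hcas') hu
    rw [h _ (hcas.sub hcas') (memLp_cas_sub_smul_cas n m), zero_mul] at hsum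
    have hterm := (hasSum_single n fun k hk => ?_).unique hsum
    · simpa [hcoeff, Pi.single_eq_of_ne hn, Real.pi_ne_zero] using hterm
    · obtain rfl | hkm := eq_or_ne k m
      · simp
      · rw [hcoeff, Pi.single_eq_of_ne hk, Pi.single_eq_of_ne hkm]
        ring
  · refine (hasSum_LplusForm m hη hu).unique ?_
    rw [zero_mul]
    refine hasSum_zero.congr_fun fun n => ?_
    linear_combination 2 * Real.pi * casCoeff η n * h n

lemma SolvesLplus.ae_eq_of_zero {m : ℕ} (hm : 1 ≤ m) {u : ℝ → ℝ} (hu : SolvesLplus m 0 u) :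
    u =ᵐ[volume] casCoeff u m • cas m + casCoeff u (-m) • cas (-m) := by
  have hcas := (memHdotHalf_cas m).smul (casCoeff u m)
  have hcas' := (memHdotHalf_cas (-m)).smul (casCoeff u (-m))
  refine (sub_ae_eq_zero _ _).1 (ae_eq_zero_of_casCoeff_eq_zero (hu.1.sub (hcas.add hcas')).memLp
    fun n => ?_)
  rw [casCoeff_sub hu.1.integrable (hcas.add hcas').integrable,
    casCoeff_add hcas.integrable hcas'.integrable, casCoeff_smul, casCoeff_smul, casCoeff_cas,
    casCoeff_cas]
  simp only [Pi.sub_apply, Pi.add_apply, Pi.smul_apply, Pi.single_apply, smul_eq_mul]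
  rcases mul_eq_zero.1 ((solvesLplus_zero_iff.1 hu).2 n) with hn | hn
  · have habs : |n| = m := by exact_mod_cast sub_eq_zero.1 hn
    rcases (abs_eq (by positivity)).1 habs with rfl | rfl
    · rw [if_pos rfl, if_neg (by lia)]
      ring
    · rw [if_neg (by lia), if_pos rfl]
      ring
  · split_ifs <;> simp_all

lemma solvesLplus_zero_cas_add_smul (m : ℕ) (c : ℝ) :
    SolvesLplus m 0 (cas m + c • cas (-m)) := by
  have hcas := memHdotHalf_cas m
  have hcas' := (memHdotHalf_cas (-m)).smul c
  refine solvesLplus_zero_iff.2 ⟨hcas.add hcas', fun n => ?_⟩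
  rw [casCoeff_add hcas.integrable hcas'.integrable, casCoeff_smul, casCoeff_cas, casCoeff_cas]
  simp only [Pi.add_apply, Pi.smul_apply, Pi.single_apply, smul_eq_mul]
  split_ifs with h₁ h₂ h₂ <;> simp [h₁, h₂]

lemma memLp_smul_cas_add_smul_cas_neg_iff {n : ℤ} {a b : ℝ} :
    MemLp (a • cas n + b • cas (-n)) 2 ↔ a + b = 0 := by
  have hodd := memLp_cas_sub_cas_neg n
  refine ⟨fun h => ?_, fun h => ?_⟩
  · by_contra hab
    refine not_memLp_cas_add_cas_neg n ?_
    convert (h.sub (hodd.const_smul ((a - b) / 2))).const_smul (2 / (a + b)) using 1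
    ext x
    simp only [Pi.add_apply, Pi.sub_apply, Pi.smul_apply, smul_eq_mul]
    field_simp
    ring
  · rw [eq_neg_of_add_eq_zero_right h, neg_smul, ← sub_eq_add_neg, ← smul_sub]
    exact hodd.const_smul a

lemma IsEigenfunction.exists_ae_eq_of_zero {m : ℕ} (hm : 1 ≤ m) {u : ℝ → ℝ}
    (hu : IsEigenfunction m 0 u) :
    ∃ c : ℝ, c ≠ 0 ∧ u =ᵐ[volume] c • (cas m - cas (-m)) := by
  have h := hu.2.2.ae_eq_of_zero hm
  have hab := memLp_smul_cas_add_smul_cas_neg_iff.1 ((memLp_congr_ae h).1 hu.1.1)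
  rw [eq_neg_of_add_eq_zero_right hab, neg_smul, ← sub_eq_add_neg, ← smul_sub] at h
  refine ⟨casCoeff u m, fun h0 => hu.2.1 ?_, h⟩
  rwa [h0, zero_smul] at h

lemma IsResonance.exists_ae_eq {m : ℕ} (hm : 1 ≤ m) {u : ℝ → ℝ} (hu : IsResonance m u) :
    ∃ a b : ℝ, a + b ≠ 0 ∧ u =ᵐ[volume] a • cas m + b • cas (-m) := by
  have h := hu.1.ae_eq_of_zero hm
  exact ⟨_, _, fun hab => hu.2 ((memLp_congr_ae h).2 (memLp_smul_cas_add_smul_cas_neg_iff.2 hab)),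
    h⟩

lemma isResonance_cas_add_cas_neg (m : ℕ) : IsResonance m (cas m + cas (-m)) := by
  have h := solvesLplus_zero_cas_add_smul m 1
  rw [one_smul] at h
  exact ⟨h, not_memLp_cas_add_cas_neg m⟩

lemma not_ae_eq_zero_of_casCoeff_ne_zero {u : ℝ → ℝ} {n : ℤ} (h : casCoeff u n ≠ 0) :
    ¬ u =ᵐ[volume] 0 := fun hu => h <| by
  rw [casCoeff_congr hu]
  simp [casCoeff]

lemma isEigenfunction_cas_sub_cas_neg {m : ℕ} (hm : 1 ≤ m) :
    IsEigenfunction m 0 (cas m - cas (-m)) := by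
  have hmem := sub_mem (cas_mem_l2DerivSpace m) (cas_mem_l2DerivSpace (-m))
  refine ⟨memH1_of_differentiable (memLp_cas_sub_cas_neg m) hmem.1 hmem.2, ?_, ?_⟩
  · refine not_ae_eq_zero_of_casCoeff_ne_zero (n := m) ?_
    rw [casCoeff_sub (memHdotHalf_cas m).integrable (memHdotHalf_cas (-m)).integrable, casCoeff_cas,
      casCoeff_cas, Pi.sub_apply, Pi.single_eq_same, Pi.single_eq_of_ne (by lia), sub_zero]
    exact one_ne_zero
  · have h := solvesLplus_zero_cas_add_smul m (-1)
    rwa [neg_one_smul, ← sub_eq_add_neg] at h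

/-! ### Hartley polynomials -/

/-- The Hartley polynomial of degree less than `m` with coefficients `b`. -/
def trigPoly (m : ℕ) (b : ℤ → ℝ) : ℝ → ℝ := ∑ n ∈ Finset.Ioo (-(m : ℤ)) m, b n • cas n

/-- The function `(1 + cos θ) B(θ)`, where `B` is the Hartley polynomial with coefficients `b`. The
eigenfunctions of `L₊` with negative eigenvalue are of this form. -/
def modeFun (m : ℕ) (b : ℤ → ℝ) : ℝ → ℝ := weight * trigPoly m b

lemma mem_Ioo_neg_iff {m : ℕ} {n : ℤ} : n ∈ Finset.Ioo (-(m : ℤ)) m ↔ |n| < m := by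
  rw [Finset.mem_Ioo, abs_lt]

lemma memHdotHalf_trigPoly (m : ℕ) (b : ℤ → ℝ) : MemHdotHalf (trigPoly m b) :=
  energySpace.sum_mem fun n _ => (memHdotHalf_cas n).smul (b n)

lemma integrable_trigPoly_mul (m : ℕ) (b : ℤ → ℝ) {f : ℝ → ℝ} (hf : Integrable f ν) :
    Integrable (trigPoly m b * f) ν := by
  rw [trigPoly, Finset.sum_mul]
  refine integrable_finsetSum' _ fun n _ => ((integrable_mul_cas hf n).smul (b n)).congr
    (.of_forall fun x => ?_)
  simp only [Pi.smul_apply, Pi.mul_apply, smul_eq_mul]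
  ring

lemma integral_trigPoly_mul (m : ℕ) (b : ℤ → ℝ) {f : ℝ → ℝ} (hf : Integrable f ν) :
    ∫ x, trigPoly m b x * f x ∂ν = ∑ n ∈ Finset.Ioo (-(m : ℤ)) m, b n * casCoeff f n := by
  have hmul (x : ℝ) : trigPoly m b x * f x =
      ∑ n ∈ Finset.Ioo (-(m : ℤ)) m, b n * (f x * cas n x) := by
    simp only [trigPoly, Finset.sum_apply, Finset.sum_mul, Pi.smul_apply, smul_eq_mul]
    exact Finset.sum_congr rfl fun n _ => by ring
  simp only [hmul]
  rw [integral_finsetSum _ fun n _ => (integrable_mul_cas hf n).const_mul _]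
  simp only [integral_const_mul, casCoeff]

lemma casCoeff_trigPoly {m : ℕ} {b : ℤ → ℝ} (hb : ∀ n : ℤ, (m : ℤ) ≤ |n| → b n = 0) :
    casCoeff (trigPoly m b) = b := by
  ext n
  rw [casCoeff, integral_trigPoly_mul m b (memHdotHalf_cas n).integrable]
  simp only [casCoeff_cas, Pi.single_apply, mul_ite, mul_one, mul_zero, Finset.sum_ite_eq',
    mem_Ioo_neg_iff]
  split_ifs with hn
  · rfl
  · exact (hb n (not_lt.1 hn)).symm

lemma casCoeff_modeFun {m : ℕ} {b : ℤ → ℝ} (hb : ∀ n : ℤ, (m : ℤ) ≤ |n| → b n = 0) :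
    casCoeff (modeFun m b) = weightOp b := by
  rw [modeFun, casCoeff_weight_mul (memHdotHalf_trigPoly m b).integrable, casCoeff_trigPoly hb]

lemma modeFun_eq_sum (m : ℕ) (b : ℤ → ℝ) :
    modeFun m b = ∑ n ∈ Finset.Ioo (-(m : ℤ)) m, b n • (weight * cas n) := by
  simp only [modeFun, trigPoly, Finset.mul_sum, mul_smul_comm]

lemma modeFun_smul (m : ℕ) (c : ℝ) (b : ℤ → ℝ) : modeFun m (c • b) = c • modeFun m b := by
  simp only [modeFun_eq_sum, Finset.smul_sum, Pi.smul_apply, smul_assoc]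

lemma memHdotHalf_modeFun (m : ℕ) (b : ℤ → ℝ) : MemHdotHalf (modeFun m b) := by
  rw [modeFun_eq_sum]
  exact energySpace.sum_mem fun n _ => (memHdotHalf_weight_mul_cas n).smul (b n)

lemma memLp_modeFun (m : ℕ) (b : ℤ → ℝ) : MemLp (modeFun m b) 2 := by
  rw [modeFun_eq_sum]
  exact memLp_finsetSum' _ fun n _ => (memLp_weight_mul_cas n).const_smul (b n)

lemma memH1_modeFun (m : ℕ) (b : ℤ → ℝ) : MemH1 (modeFun m b) := by
  have hmem : modeFun m b ∈ l2DerivSpace := by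
    rw [modeFun_eq_sum]
    exact sum_mem fun n _ => Submodule.smul_mem _ _ (weight_mul_cas_mem_l2DerivSpace n)
  exact memH1_of_differentiable (memLp_modeFun m b) hmem.1 hmem.2

lemma modeFun_mul_apply (m : ℕ) (b : ℤ → ℝ) (f : ℝ → ℝ) (x : ℝ) :
    modeFun m b x * f x = 2 / (1 + x ^ 2) * (trigPoly m b x * f x) := mul_assoc _ _ _

lemma integrable_modeFun_mul (m : ℕ) (b : ℤ → ℝ) {f : ℝ → ℝ} (hf : Integrable f ν) :
    Integrable fun x => modeFun m b x * f x := by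
  simp only [modeFun_mul_apply]
  exact integrable_div_one_add_sq_mul (integrable_trigPoly_mul m b hf) 2

lemma integral_modeFun_mul (m : ℕ) (b : ℤ → ℝ) {f : ℝ → ℝ} (hf : Integrable f ν) :
    ∫ x, modeFun m b x * f x =
      2 * Real.pi * ∑ n ∈ Finset.Ioo (-(m : ℤ)) m, b n * casCoeff f n := by
  simp only [modeFun_mul_apply]
  rw [integral_div_one_add_sq_mul, integral_trigPoly_mul m b hf]

lemma eq_zero_of_modeFun_ae_eq_zero {m : ℕ} {b : ℤ → ℝ} (hb : ∀ n : ℤ, (m : ℤ) ≤ |n| → b n = 0)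
    (h : modeFun m b =ᵐ[volume] 0) : b = 0 := by
  ext n
  by_contra hn
  refine not_ae_eq_zero_of_casCoeff_ne_zero (u := trigPoly m b) (n := n) ?_ ?_
  · rwa [casCoeff_trigPoly hb]
  · exact h.mono fun x hx => (mul_eq_zero.1 hx).resolve_left (weight_pos x).ne'

/-! ### The Jacobi matrix -/

/-- The operator `b ↦ (|n| - m) (1 + cos θ) b` on Hartley coefficients, whose eigenvectors supported
on `|n| < m` give the eigenfunctions of `L₊` with negative eigenvalue. -/
def coeffOp (m : ℕ) : Module.End ℝ (ℤ → ℝ) :=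
  LinearMap.mulLeft ℝ (fun n : ℤ => |(n : ℝ)| - m) ∘ₗ weightOp

lemma coeffOp_apply (m : ℕ) (b : ℤ → ℝ) (n : ℤ) :
    coeffOp m b n = (|(n : ℝ)| - m) * weightOp b n := rfl

/-- `b` is an eigenvector of `coeffOp m` supported on `|n| < m`, with eigenvalue `e`. -/
structure IsMode (m : ℕ) (e : ℝ) (b : ℤ → ℝ) : Prop where
  eq_zero_of_le : ∀ n : ℤ, (m : ℤ) ≤ |n| → b n = 0
  hasEigenvector : (coeffOp m).HasEigenvector e b

lemma IsMode.smul {m : ℕ} {e c : ℝ} {b : ℤ → ℝ} (hb : IsMode m e b) (hc : c ≠ 0) :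
    IsMode m e (c • b) :=
  ⟨fun n hn => by rw [Pi.smul_apply, hb.eq_zero_of_le n hn, smul_zero],
    Submodule.smul_mem _ c hb.hasEigenvector.1, smul_ne_zero hc hb.hasEigenvector.2⟩

-- The eigenvalue equation is a three-term recursion, so it is solved from the left end of the band.
lemma eq_zero_of_coeffOp_eq_smul {m : ℕ} {e : ℝ} {b : ℤ → ℝ}
    (hb : ∀ n : ℤ, (m : ℤ) ≤ |n| → b n = 0) (h : coeffOp m b = e • b) (h0 : b (1 - m) = 0) :
    b = 0 := by
  have hrec : ∀ n : ℤ, -(m : ℤ) ≤ n → b n = 0 ∧ b (n + 1) = 0 := by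
    refine Int.leInduction ⟨hb _ (by simp), by rwa [neg_add_eq_sub]⟩ fun n hn ih => ⟨ih.2, ?_⟩
    by_cases hlt : |n + 1| < m
    · have heq := congrFun h (n + 1)
      rw [coeffOp_apply, weightOp_apply, Pi.smul_apply, add_sub_cancel_right, ih.1, ih.2] at heq
      have hne : |((n + 1 : ℤ) : ℝ)| - m ≠ 0 := sub_ne_zero.2 (by exact_mod_cast hlt.ne)
      linarith [(mul_eq_zero.1 (heq.trans (smul_zero e))).resolve_left hne]
    · exact hb _ (by rw [le_abs]; rw [abs_lt] at hlt; lia)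
  ext n
  by_cases hn : -(m : ℤ) ≤ n
  · exact (hrec n hn).1
  · exact hb n (by rw [le_abs]; lia)

lemma IsMode.exists_eq_smul {m : ℕ} {e : ℝ} {b c : ℤ → ℝ} (hb : IsMode m e b)
    (hc : IsMode m e c) : ∃ r : ℝ, c = r • b := by
  set s : ℤ := 1 - m
  have hs : b s ≠ 0 := fun h0 => hb.hasEigenvector.2
    (eq_zero_of_coeffOp_eq_smul hb.eq_zero_of_le hb.hasEigenvector.apply_eq_smul h0)
  refine ⟨c s / b s, sub_eq_zero.1 (eq_zero_of_coeffOp_eq_smul (m := m) (e := e)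
    (fun n hn => ?_) ?_ ?_)⟩
  · simp [hb.eq_zero_of_le n hn, hc.eq_zero_of_le n hn]
  · rw [map_sub, map_smul, hb.hasEigenvector.apply_eq_smul, hc.hasEigenvector.apply_eq_smul,
      smul_sub, smul_comm]
  · simp [hs, s]

/-- The coefficients `√(m - |n|) c n` supported on `|n| < m`; the rescaling makes `coeffOp m`
symmetric. -/
def scaledCoeff (m : ℕ) : EuclideanSpace ℝ (Finset.Ioo (-(m : ℤ)) m) →ₗ[ℝ] ℤ → ℝ where
  toFun c n := if h : n ∈ Finset.Ioo (-(m : ℤ)) m then √(m - |(n : ℝ)|) * c ⟨n, h⟩ else 0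
  map_add' c d := by
    ext n
    simp only [Pi.add_apply, PiLp.add_apply]
    split_ifs <;> ring
  map_smul' r c := by
    ext n
    simp only [Pi.smul_apply, PiLp.smul_apply, smul_eq_mul, RingHom.id_apply]
    split_ifs <;> ring

lemma scaledCoeff_of_le {m : ℕ} (c : EuclideanSpace ℝ (Finset.Ioo (-(m : ℤ)) m)) (n : ℤ)
    (h : (m : ℤ) ≤ |n|) : scaledCoeff m c n = 0 :=
  dif_neg fun hn => h.not_gt (mem_Ioo_neg_iff.1 hn)

lemma scaledCoeff_coe {m : ℕ} (c : EuclideanSpace ℝ (Finset.Ioo (-(m : ℤ)) m))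
    (p : Finset.Ioo (-(m : ℤ)) (m : ℤ)) :
    scaledCoeff m c p = √(m - |((p : ℤ) : ℝ)|) * c p := dif_pos p.2

lemma sub_abs_pos {m : ℕ} (p : Finset.Ioo (-(m : ℤ)) (m : ℤ)) :
    0 < (m : ℝ) - |((p : ℤ) : ℝ)| :=
  sub_pos.2 (by exact_mod_cast mem_Ioo_neg_iff.1 p.2)

lemma scaledCoeff_injective (m : ℕ) : Function.Injective (scaledCoeff m) := by
  refine (injective_iff_map_eq_zero _).2 fun c hc => ?_
  ext p
  have h := congrFun hc p
  rw [scaledCoeff_coe] at h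
  exact (mul_eq_zero.1 h).resolve_left (Real.sqrt_pos.2 (sub_abs_pos p)).ne'

/-- The Jacobi operator `√(m - |n|) (1 + cos θ) √(m - |n|)`, whose eigenvalues are minus the
negative eigenvalues of `L₊`. -/
def jacobiOp (m : ℕ) : Module.End ℝ (EuclideanSpace ℝ (Finset.Ioo (-(m : ℤ)) m)) where
  toFun c := WithLp.toLp 2 fun p => √(m - |((p : ℤ) : ℝ)|) * weightOp (scaledCoeff m c) p
  map_add' c d := by
    ext p
    simp only [map_add, Pi.add_apply, PiLp.add_apply]
    ring
  map_smul' r c := by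
    ext p
    simp only [map_smul, Pi.smul_apply, PiLp.smul_apply, RingHom.id_apply, smul_eq_mul]
    ring

lemma jacobiOp_apply (m : ℕ) (c : EuclideanSpace ℝ (Finset.Ioo (-(m : ℤ)) m))
    (p : Finset.Ioo (-(m : ℤ)) (m : ℤ)) :
    jacobiOp m c p = √(m - |((p : ℤ) : ℝ)|) * weightOp (scaledCoeff m c) p := rfl

lemma inner_jacobiOp (m : ℕ) (c d : EuclideanSpace ℝ (Finset.Ioo (-(m : ℤ)) m)) :
    inner ℝ (jacobiOp m c) d =
      ∫ x, trigPoly m (scaledCoeff m d) x * modeFun m (scaledCoeff m c) x ∂ν := by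
  rw [integral_trigPoly_mul m _ (memHdotHalf_modeFun m _).integrable,
    casCoeff_modeFun (scaledCoeff_of_le c), PiLp.inner_apply,
    ← Finset.sum_coe_sort (Finset.Ioo (-(m : ℤ)) m)]
  refine Finset.sum_congr rfl fun p _ => ?_
  rw [jacobiOp_apply, scaledCoeff_coe d, RCLike.inner_apply, conj_trivial]
  ring

lemma jacobiOp_isSymmetric (m : ℕ) : (jacobiOp m).IsSymmetric := by
  intro c d
  rw [inner_jacobiOp, real_inner_comm, inner_jacobiOp]
  refine integral_congr_ae (.of_forall fun x => ?_)
  simp only [modeFun, Pi.mul_apply]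
  ring

lemma inner_jacobiOp_self_pos {m : ℕ} {c : EuclideanSpace ℝ (Finset.Ioo (-(m : ℤ)) m)}
    (hc : c ≠ 0) : 0 < inner ℝ (jacobiOp m c) c := by
  rw [inner_jacobiOp]
  set C := trigPoly m (scaledCoeff m c)
  have hmul (x : ℝ) : C x * modeFun m (scaledCoeff m c) x = weight x * C x ^ 2 := by
    rw [modeFun, Pi.mul_apply]
    ring
  have hnonneg (x : ℝ) : 0 ≤ C x * modeFun m (scaledCoeff m c) x := by
    rw [hmul]
    exact mul_nonneg (weight_pos x).le (sq_nonneg _)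
  have hint := integrable_trigPoly_mul m (scaledCoeff m c)
    (memHdotHalf_modeFun m (scaledCoeff m c)).integrable
  refine (integral_nonneg hnonneg).lt_of_ne fun h0 => hc ?_
  have hae := (integral_eq_zero_iff_of_nonneg hnonneg hint).1 h0.symm
  refine (map_eq_zero_iff _ (scaledCoeff_injective m)).1
    (eq_zero_of_modeFun_ae_eq_zero (scaledCoeff_of_le c) ?_)
  refine (absolutelyContinuous_cauchyMeasure.ae_eq hae).mono fun x hx => ?_
  exact (mul_eq_zero.1 hx).elim (fun h => mul_eq_zero_of_right _ h) id

lemma isMode_scaledCoeff {m : ℕ} {μ : ℝ} {c : EuclideanSpace ℝ (Finset.Ioo (-(m : ℤ)) m)}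
    (h : (jacobiOp m).HasEigenvector μ c) : IsMode m (-μ) (scaledCoeff m c) := by
  refine ⟨scaledCoeff_of_le c, Module.End.mem_eigenspace_iff.2 ?_,
    (map_ne_zero_iff _ (scaledCoeff_injective m)).2 h.2⟩
  ext n
  rw [coeffOp_apply, Pi.smul_apply, smul_eq_mul]
  obtain hn | hn | hn := lt_trichotomy |n| m
  · set p : Finset.Ioo (-(m : ℤ)) (m : ℤ) := ⟨n, mem_Ioo_neg_iff.2 hn⟩
    have heigen : √(m - |(n : ℝ)|) * weightOp (scaledCoeff m c) n = μ * c p :=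
      congrArg (fun v : EuclideanSpace ℝ _ => v p) h.apply_eq_smul
    have hcoe : scaledCoeff m c n = √(m - |(n : ℝ)|) * c p := scaledCoeff_coe c p
    have hsqrt : √(m - |(n : ℝ)|) * √(m - |(n : ℝ)|) = m - |(n : ℝ)| :=
      Real.mul_self_sqrt (sub_abs_pos p).le
    linear_combination -√(m - |(n : ℝ)|) * heigen + weightOp (scaledCoeff m c) n * hsqrt +
      μ * hcoe
  · have habs : |(n : ℝ)| = m := by exact_mod_cast hn
    rw [habs, scaledCoeff_of_le c n hn.ge]
    ring
  · rw [weightOp_apply, scaledCoeff_of_le c n hn.le, scaledCoeff_of_le c (n - 1),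
      scaledCoeff_of_le c (n + 1)]
    · ring
    · rw [lt_abs] at hn
      rw [le_abs]
      lia
    · rw [lt_abs] at hn
      rw [le_abs]
      lia

lemma finrank_euclideanSpace_Ioo (m : ℕ) :
    Module.finrank ℝ (EuclideanSpace ℝ (Finset.Ioo (-(m : ℤ)) (m : ℤ))) = 2 * m - 1 := by
  rw [finrank_euclideanSpace, Fintype.card_coe, Int.card_Ioo]
  lia

lemma jacobiOp_eigenvalues_injective (m : ℕ) : Function.Injective
    ((jacobiOp_isSymmetric m).eigenvalues (finrank_euclideanSpace_Ioo m)) := by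
  intro i j hij
  set v := (jacobiOp_isSymmetric m).eigenvectorBasis (finrank_euclideanSpace_Ioo m)
  have hi := isMode_scaledCoeff ((jacobiOp_isSymmetric m).hasEigenvector_eigenvectorBasis
    (finrank_euclideanSpace_Ioo m) i)
  have hj := isMode_scaledCoeff ((jacobiOp_isSymmetric m).hasEigenvector_eigenvectorBasis
    (finrank_euclideanSpace_Ioo m) j)
  rw [← hij] at hj
  obtain ⟨r, hr⟩ := hi.exists_eq_smul hj
  rw [← map_smul] at hr
  have hv : v j = r • v i := scaledCoeff_injective m hr
  by_contra hne
  have hself := v.inner_eq_one j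
  nth_rw 1 [hv] at hself
  rw [inner_smul_left, v.inner_eq_zero hne, mul_zero] at hself
  exact zero_ne_one hself

lemma exists_strictMono_isMode (m : ℕ) :
    ∃ (e : Fin (2 * m - 1) → ℝ) (b : Fin (2 * m - 1) → ℤ → ℝ),
      StrictMono e ∧ (∀ k, e k < 0) ∧ ∀ k, IsMode m (e k) (b k) := by
  have hT := jacobiOp_isSymmetric m
  have hdim := finrank_euclideanSpace_Ioo m
  have heigen := hT.hasEigenvector_eigenvectorBasis hdim
  refine ⟨fun k => -hT.eigenvalues hdim k, fun k => scaledCoeff m (hT.eigenvectorBasis hdim k),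
    ((hT.eigenvalues_antitone hdim).strictAnti_of_injective
      (jacobiOp_eigenvalues_injective m)).neg, fun k => ?_, fun k => isMode_scaledCoeff (heigen k)⟩
  have hpos := inner_jacobiOp_self_pos (heigen k).2
  rw [(heigen k).apply_eq_smul, inner_smul_left, OrthonormalBasis.inner_eq_one] at hpos
  simpa using hpos

lemma linearIndependent_restrict_of_isMode {ι : Type*} {m : ℕ} {e : ι → ℝ}
    (he : Function.Injective e) {b : ι → ℤ → ℝ} (hb : ∀ k, IsMode m (e k) (b k)) :
    LinearIndependent ℝ fun k (p : Finset.Ioo (-(m : ℤ)) (m : ℤ)) => b k p := by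
  refine .of_comp (Function.ExtendByZero.linearMap ℝ Subtype.val) ?_
  have hextend : Function.ExtendByZero.linearMap ℝ Subtype.val ∘
      (fun k (p : Finset.Ioo (-(m : ℤ)) (m : ℤ)) => b k p) = b := by
    ext k n
    change Function.extend Subtype.val (fun p : Finset.Ioo (-(m : ℤ)) (m : ℤ) => b k p) 0 n = b k n
    by_cases hn : n ∈ Finset.Ioo (-(m : ℤ)) m
    · exact Subtype.val_injective.extend_apply _ _ (⟨n, hn⟩ : Finset.Ioo (-(m : ℤ)) (m : ℤ))
    · rw [Function.extend_apply' _ _ _ (by rintro ⟨p, rfl⟩; exact hn p.2), Pi.zero_apply,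
        (hb k).eq_zero_of_le n (not_lt.1 fun h => hn (mem_Ioo_neg_iff.2 h))]
  rw [hextend]
  exact Module.End.eigenvectors_linearIndependent' (coeffOp m) e he b
    fun k => (hb k).hasEigenvector

lemma forall_integral_modeFun_mul_eq_zero_iff {m : ℕ} {e : Fin (2 * m - 1) → ℝ}
    (he : Function.Injective e) {b : Fin (2 * m - 1) → ℤ → ℝ} (hb : ∀ k, IsMode m (e k) (b k))
    {f : ℝ → ℝ} (hf : Integrable f ν) :
    (∀ k, ∫ x, modeFun m (b k) x * f x = 0) ↔ ∀ n : ℤ, |n| < m → casCoeff f n = 0 := by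
  refine ⟨fun h n hn => ?_, fun h k => ?_⟩
  · have hspan := (linearIndependent_restrict_of_isMode he hb).span_eq_top_of_card_eq_finrank' (by
      rw [Module.finrank_fintype_fun_eq_card, Fintype.card_fin, Fintype.card_coe, Int.card_Ioo]
      lia)
    have hzero : Fintype.linearCombination ℝ
        (fun p : Finset.Ioo (-(m : ℤ)) (m : ℤ) => casCoeff f p) = 0 := by
      refine LinearMap.ext_on_range hspan fun k => ?_
      have hsum := h k
      rw [integral_modeFun_mul m _ hf, ← Finset.sum_coe_sort] at hsum
      exact (mul_eq_zero.1 hsum).resolve_left Real.two_pi_pos.ne'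
    simpa using LinearMap.congr_fun hzero (Pi.single ⟨n, mem_Ioo_neg_iff.2 hn⟩ 1)
  · rw [integral_modeFun_mul m _ hf,
      Finset.sum_eq_zero fun n hn => by rw [h n (mem_Ioo_neg_iff.1 hn), mul_zero], mul_zero]

/-! ### Eigenfunctions with negative eigenvalue -/

lemma LplusForm_sub_smul_right (m : ℕ) (c : ℝ) {f g h : ℝ → ℝ} (hf : MemHdotHalf f)
    (hg : MemHdotHalf g) (hh : MemHdotHalf h) :
    LplusForm m f (g - c • h) = LplusForm m f g - c * LplusForm m f h := by
  refine (hasSum_LplusForm m hf (hg.sub (hh.smul c))).unique ?_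
  refine ((hasSum_LplusForm m hf hg).sub
    ((hasSum_LplusForm m hf hh).mul_left c)).congr_fun fun n => ?_
  rw [casCoeff_sub hg.integrable (hh.smul c).integrable, casCoeff_smul, Pi.sub_apply,
    Pi.smul_apply, smul_eq_mul]
  ring

lemma integral_mul_sub_smul {f g h : ℝ → ℝ} (hf : MemLp f 2) (hg : MemLp g 2) (hh : MemLp h 2)
    (c : ℝ) : ∫ x, f x * (g - c • h) x = (∫ x, f x * g x) - c * ∫ x, f x * h x := by
  have hmul (x : ℝ) : f x * (g - c • h) x = f x * g x - c * (f x * h x) := by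
    simp only [Pi.sub_apply, Pi.smul_apply, smul_eq_mul]
    ring
  have hfg : Integrable fun x => f x * g x := hf.integrable_mul hg
  have hfh : Integrable fun x => f x * h x := hf.integrable_mul hh
  simp only [hmul]
  rw [integral_sub hfg (hfh.const_mul c), integral_const_mul]

lemma SolvesLplus.sub_smul {m : ℕ} {e : ℝ} {u v : ℝ → ℝ} (hu : SolvesLplus m e u)
    (hv : SolvesLplus m e v) (hu2 : MemLp u 2) (hv2 : MemLp v 2) (c : ℝ) :
    SolvesLplus m e (u - c • v) := by
  refine ⟨hu.1.sub (hv.1.smul c), fun η hη hη2 => ?_⟩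
  rw [LplusForm_sub_smul_right m c hη hu.1 hv.1, hu.2 η hη hη2, hv.2 η hη hη2,
    integral_mul_sub_smul hη2 hu2 hv2]
  ring

lemma SolvesLplus.ae_eq_zero {m : ℕ} {e : ℝ} (he : e < 0) {u : ℝ → ℝ} (hu : SolvesLplus m e u)
    (hu2 : MemLp u 2) (h0 : ∀ n : ℤ, |n| < m → casCoeff u n = 0) : u =ᵐ[volume] 0 := by
  have hform : 0 ≤ LplusForm m u u := by
    refine (hasSum_LplusForm m hu.1 hu.1).nonneg fun n => ?_
    by_cases hn : |n| < m
    · simp [h0 n hn]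
    · have hle : (m : ℝ) ≤ |(n : ℝ)| := by exact_mod_cast not_lt.1 hn
      exact mul_nonneg Real.two_pi_pos.le (mul_nonneg (sub_nonneg.2 hle) (mul_self_nonneg _))
  rw [hu.2 u hu.1 hu2] at hform
  have hsq (x : ℝ) : 0 ≤ u x * u x := mul_self_nonneg _
  have hint : ∫ x, u x * u x = 0 :=
    (nonpos_of_mul_nonneg_right hform he).antisymm (integral_nonneg hsq)
  exact ((integral_eq_zero_iff_of_nonneg hsq (hu2.integrable_mul hu2)).1 hint).mono
    fun x hx => mul_self_eq_zero.1 hx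

lemma IsMode.LplusForm_modeFun {m : ℕ} {e : ℝ} {b : ℤ → ℝ} (hb : IsMode m e b) {f : ℝ → ℝ}
    (hf : MemHdotHalf f) : LplusForm m f (modeFun m b) = e * ∫ x, modeFun m b x * f x := by
  have hsum : HasSum (fun n => b n * casCoeff f n)
      (∑ n ∈ Finset.Ioo (-(m : ℤ)) m, b n * casCoeff f n) :=
    hasSum_sum_of_ne_finset_zero fun n hn => by
      rw [hb.eq_zero_of_le n (not_lt.1 fun h => hn (mem_Ioo_neg_iff.2 h)), zero_mul]
  rw [integral_modeFun_mul m b hf.integrable]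
  refine (hasSum_LplusForm m hf (memHdotHalf_modeFun m b)).unique
    (((hsum.mul_left (2 * Real.pi)).mul_left e).congr_fun fun n => ?_)
  have heigen := congrFun hb.hasEigenvector.apply_eq_smul n
  rw [coeffOp_apply, Pi.smul_apply, smul_eq_mul] at heigen
  rw [casCoeff_modeFun hb.eq_zero_of_le]
  linear_combination 2 * Real.pi * casCoeff f n * heigen

lemma IsMode.isEigenfunction {m : ℕ} {e : ℝ} {b : ℤ → ℝ} (hb : IsMode m e b) :
    IsEigenfunction m e (modeFun m b) := by
  refine ⟨memH1_modeFun m b,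
    fun h => hb.hasEigenvector.2 (eq_zero_of_modeFun_ae_eq_zero hb.eq_zero_of_le h),
    memHdotHalf_modeFun m b, fun η hη _ => ?_⟩
  simp only [hb.LplusForm_modeFun hη, mul_comm (η _)]

lemma SolvesLplus.integral_modeFun_mul_eq_zero {m : ℕ} {e e' : ℝ} {b : ℤ → ℝ} {u : ℝ → ℝ}
    (hu : SolvesLplus m e u) (hb : IsMode m e' b) (hne : e ≠ e') :
    ∫ x, modeFun m b x * u x = 0 := by
  have hform := hu.2 _ (memHdotHalf_modeFun m b) (memLp_modeFun m b)
  rw [LplusForm_comm, hb.LplusForm_modeFun hu.1] at hform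
  by_contra h0
  exact hne (mul_right_cancel₀ h0 hform).symm

lemma IsEigenfunction.integral_mul_self_ne_zero {m : ℕ} {e : ℝ} {u : ℝ → ℝ}
    (hu : IsEigenfunction m e u) : ∫ x, u x * u x ≠ 0 := fun h =>
  hu.2.1 <| ((integral_eq_zero_iff_of_nonneg (fun x => mul_self_nonneg (u x))
    (hu.1.1.integrable_mul hu.1.1)).1 h).mono fun _ hx => mul_self_eq_zero.1 hx

lemma IsEigenfunction.exists_ae_eq_smul_modeFun {m : ℕ} {E : Fin (2 * m - 1) → ℝ}
    (hE : Function.Injective E) {b : Fin (2 * m - 1) → ℤ → ℝ} (hb : ∀ k, IsMode m (E k) (b k))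
    {e : ℝ} (he : e < 0) {u : ℝ → ℝ} (hu : IsEigenfunction m e u) :
    ∃ k, e = E k ∧ ∃ c : ℝ, c ≠ 0 ∧ u =ᵐ[volume] c • modeFun m (b k) := by
  have hzero (v : ℝ → ℝ) (hv : SolvesLplus m e v) (hv2 : MemLp v 2)
      (horth : ∀ k, ∫ x, modeFun m (b k) x * v x = 0) : v =ᵐ[volume] 0 :=
    hv.ae_eq_zero he hv2 ((forall_integral_modeFun_mul_eq_zero_iff hE hb hv.1.integrable).1 horth)
  obtain ⟨k, rfl⟩ : ∃ k, e = E k := by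
    by_contra! hne
    exact hu.2.1 (hzero u hu.2.2 hu.1.1 fun k => hu.2.2.integral_modeFun_mul_eq_zero (hb k) (hne k))
  have hφ := (hb k).isEigenfunction
  set φ := modeFun m (b k)
  set c := (∫ x, φ x * u x) / ∫ x, φ x * φ x with hc
  have hv := hu.2.2.sub_smul hφ.2.2 hu.1.1 hφ.1.1 c
  have hvφ : ∫ x, φ x * (u - c • φ) x = 0 := by
    rw [integral_mul_sub_smul hφ.1.1 hu.1.1 hφ.1.1, hc,
      div_mul_cancel₀ _ hφ.integral_mul_self_ne_zero, sub_self]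
  have huφ : u =ᵐ[volume] c • φ := by
    refine (sub_ae_eq_zero _ _).1 (hzero _ hv (hu.1.1.sub (hφ.1.1.const_smul c)) fun j => ?_)
    obtain rfl | hj := eq_or_ne k j
    · exact hvφ
    · exact hv.integral_modeFun_mul_eq_zero (hb j) (hE.ne hj)
  refine ⟨k, rfl, c, fun h0 => hu.2.1 ?_, huφ⟩
  rwa [h0, zero_smul] at huφ

lemma IsEigenfunction.exists_isMode {m : ℕ} {e : ℝ} (he : e < 0) {u : ℝ → ℝ}
    (hu : IsEigenfunction m e u) : ∃ b, IsMode m e b ∧ u =ᵐ[volume] modeFun m b := by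
  obtain ⟨E, b, hE, -, hb⟩ := exists_strictMono_isMode m
  obtain ⟨k, rfl, c, hc, hu⟩ := hu.exists_ae_eq_smul_modeFun hE.injective hb he
  exact ⟨c • b k, (hb k).smul hc, by rwa [modeFun_smul]⟩

/-! ### Bound states -/

lemma exists_isBoundStateFamily {m : ℕ} (hm : 1 ≤ m) :
    ∃ (E : Fin (2 * m) → ℝ) (φ : Fin (2 * m) → ℝ → ℝ) (χ : ℝ → ℝ),
      IsBoundStateFamily m E φ χ ∧
      ∀ (e : ℝ) (u : ℝ → ℝ), e ≤ 0 → IsEigenfunction m e u →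
        ∃ (k : Fin (2 * m)) (c : ℝ), e = E k ∧ u =ᵐ[volume] fun x => c * φ k x := by
  obtain ⟨E, b, hE, hneg, hb⟩ := exists_strictMono_isMode m
  refine ⟨fun k => if h : (k : ℕ) < 2 * m - 1 then E ⟨k, h⟩ else 0,
    fun k => if h : (k : ℕ) < 2 * m - 1 then modeFun m (b ⟨k, h⟩) else cas m - cas (-m),
    cas m + cas (-m), ⟨fun i j hij => ?_, fun k hk => ?_, fun k hk => ?_, fun k => ?_,
      isResonance_cas_add_cas_neg m⟩, fun e u he hu => ?_⟩
  · have hi : (i : ℕ) < 2 * m - 1 := by lia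
    simp only [dif_pos hi]
    split_ifs with hj
    · exact hE hij
    · exact hneg _
  · simp only [dif_pos (show (k : ℕ) < 2 * m - 1 by lia)]
    exact hneg _
  · exact dif_neg (by lia)
  · split_ifs with hk
    · exact (hb _).isEigenfunction
    · exact isEigenfunction_cas_sub_cas_neg hm
  · obtain he | rfl := he.lt_or_eq
    · obtain ⟨k, hk, c, -, hu⟩ := hu.exists_ae_eq_smul_modeFun hE.injective hb he
      refine ⟨⟨k, by lia⟩, c, ?_⟩
      simp only [dif_pos k.2]
      exact ⟨hk, hu⟩
    · obtain ⟨c, -, hu⟩ := hu.exists_ae_eq_of_zero hm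
      refine ⟨⟨2 * m - 1, by lia⟩, c, ?_⟩
      simp only [dif_neg (lt_irrefl _)]
      exact ⟨trivial, hu⟩

lemma forall_psi_iff {m : ℕ} (hm : 1 ≤ m) (φ : Fin (2 * m) → ℝ → ℝ) (χ : ℝ → ℝ)
    (P : (ℝ → ℝ) → Prop) : (∀ k, P (psi m φ χ k)) ↔
      (∀ k : Fin (2 * m - 1), P (φ ⟨k, by lia⟩)) ∧
        P (fun x => φ ⟨2 * m - 1, by lia⟩ x / (1 + x ^ 2)) ∧ P fun x => χ x / (1 + x ^ 2) := by
  have hneg : ∀ k : Fin (2 * m - 1), psi m φ χ ⟨k, by lia⟩ = φ ⟨k, by lia⟩ := fun k => by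
    ext x
    rw [psi, dif_pos (by simp only; lia), if_pos (by simp only; lia)]
  have hzero : psi m φ χ ⟨2 * m - 1, by lia⟩ =
      fun x => φ ⟨2 * m - 1, by lia⟩ x / (1 + x ^ 2) := by
    ext x
    rw [psi, dif_pos (by simp only; lia), if_neg (by simp only; lia)]
  have hlast : psi m φ χ ⟨2 * m, by lia⟩ = fun x => χ x / (1 + x ^ 2) := by
    ext x
    rw [psi, dif_neg (by simp only; lia)]
  refine ⟨fun h => ⟨fun k => hneg k ▸ h _, hzero ▸ h _, hlast ▸ h _⟩,
    fun ⟨h₁, h₂, h₃⟩ k => ?_⟩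
  obtain hk | hk | hk := lt_trichotomy (k : ℕ) (2 * m - 1)
  · exact (hneg ⟨k, hk⟩).symm ▸ h₁ ⟨k, hk⟩
  · rwa [show k = ⟨2 * m - 1, by lia⟩ from Fin.ext hk, hzero]
  · rwa [show k = ⟨2 * m, by lia⟩ from Fin.ext (by simp only; lia), hlast]

lemma integrable_div_one_add_sq_mul_of_memHdotHalf {f u : ℝ → ℝ} (hu : MemHdotHalf u)
    (hf : MemHdotHalf f) : Integrable fun x => u x / (1 + x ^ 2) * f x :=
  (integrable_div_one_add_sq_mul (hu.memLp.integrable_mul hf.memLp) 1).congr <|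
    .of_forall fun x => by
      simp only [Pi.mul_apply]
      ring

lemma integral_div_one_add_sq_mul_of_ae_eq {a b : ℝ} {k n : ℤ} {f u : ℝ → ℝ}
    (hu : u =ᵐ[volume] a • cas k + b • cas n) (hf : Integrable f ν) :
    ∫ x, u x / (1 + x ^ 2) * f x = Real.pi * (a * casCoeff f k + b * casCoeff f n) := by
  have hae : (fun x => u x / (1 + x ^ 2) * f x) =ᵐ[volume] fun x =>
      1 / (1 + x ^ 2) * (a * (f x * cas k x) + b * (f x * cas n x)) := hu.mono fun x hx => by
    simp only [hx, Pi.add_apply, Pi.smul_apply, smul_eq_mul]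
    ring
  rw [integral_congr_ae hae, integral_div_one_add_sq_mul, one_mul,
    integral_add ((integrable_mul_cas hf k).const_mul a) ((integrable_mul_cas hf n).const_mul b),
    integral_const_mul, integral_const_mul, casCoeff, casCoeff]

section BoundStates

variable {m : ℕ} {E : Fin (2 * m) → ℝ} {φ : Fin (2 * m) → ℝ → ℝ} {χ f : ℝ → ℝ}

lemma IsBoundStateFamily.neg_of_lt (h : IsBoundStateFamily m E φ χ) (k : Fin (2 * m - 1)) :
    E ⟨k, by lia⟩ < 0 := h.neg _ (by simp only; lia)

lemma IsBoundStateFamily.integrable_psi_mul (hm : 1 ≤ m) (h : IsBoundStateFamily m E φ χ)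
    (hf : MemHdotHalf f) (k : Fin (2 * m + 1)) : Integrable fun x => psi m φ χ k x * f x := by
  refine (forall_psi_iff hm φ χ fun ψ => Integrable fun x => ψ x * f x).2 ⟨fun k => ?_,
    integrable_div_one_add_sq_mul_of_memHdotHalf (h.eigen _).2.2.1 hf,
    integrable_div_one_add_sq_mul_of_memHdotHalf h.resonance.1.1 hf⟩ k
  obtain ⟨b, -, hφ⟩ := (h.eigen ⟨k, by lia⟩).exists_isMode (h.neg_of_lt k)
  exact (integrable_modeFun_mul m b hf.integrable).congr
    (hφ.symm.mono fun x hx => congrArg (· * f x) hx)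

lemma IsBoundStateFamily.forall_integral_mul_eq_zero_iff (h : IsBoundStateFamily m E φ χ)
    (hf : Integrable f ν) :
    (∀ k : Fin (2 * m - 1), ∫ x, φ ⟨k, by lia⟩ x * f x = 0) ↔
      ∀ n : ℤ, |n| < m → casCoeff f n = 0 := by
  choose b hb hφ using fun k : Fin (2 * m - 1) =>
    (h.eigen ⟨k, by lia⟩).exists_isMode (h.neg_of_lt k)
  have hE : Function.Injective fun k : Fin (2 * m - 1) => E ⟨k, by lia⟩ :=
    h.strictMono.injective.comp (Fin.castLE_injective (Nat.sub_le _ 1))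
  rw [← forall_integral_modeFun_mul_eq_zero_iff hE hb hf]
  refine forall_congr' fun k => ?_
  rw [integral_congr_ae ((hφ k).mono fun x hx => congrArg (· * f x) hx)]

lemma IsBoundStateFamily.integral_div_one_add_sq_mul_eq_zero_iff (hm : 1 ≤ m)
    (h : IsBoundStateFamily m E φ χ) (hf : Integrable f ν) :
    (∫ x, φ ⟨2 * m - 1, by lia⟩ x / (1 + x ^ 2) * f x = 0 ∧
      ∫ x, χ x / (1 + x ^ 2) * f x = 0) ↔ casCoeff f m = 0 ∧ casCoeff f (-m) = 0 := by
  have heigen := h.eigen ⟨2 * m - 1, by lia⟩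
  rw [h.zero _ (by simp only; lia)] at heigen
  obtain ⟨c, hc, hφ⟩ := heigen.exists_ae_eq_of_zero hm
  obtain ⟨a, b, hab, hχ⟩ := h.resonance.exists_ae_eq hm
  rw [smul_sub, sub_eq_add_neg, ← neg_smul] at hφ
  rw [integral_div_one_add_sq_mul_of_ae_eq hφ hf, integral_div_one_add_sq_mul_of_ae_eq hχ hf,
    mul_eq_zero_iff_left Real.pi_ne_zero, mul_eq_zero_iff_left Real.pi_ne_zero]
  refine ⟨fun ⟨hodd, heven⟩ => ?_, fun ⟨h₁, h₂⟩ => by simp [h₁, h₂]⟩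
  have heq : casCoeff f m = casCoeff f (-m) := by
    refine mul_left_cancel₀ hc ?_
    linear_combination hodd
  rw [heq, ← add_mul] at heven
  have hz := (mul_eq_zero.1 heven).resolve_left hab
  exact ⟨heq.trans hz, hz⟩

lemma IsBoundStateFamily.orthPsi_iff (hm : 1 ≤ m) (h : IsBoundStateFamily m E φ χ)
    (hf : Integrable f ν) : OrthPsi m φ χ f ↔ ∀ n : ℤ, |n| ≤ m → casCoeff f n = 0 := by
  rw [OrthPsi, forall_psi_iff hm φ χ fun ψ => ∫ x, ψ x * f x = 0,
    h.forall_integral_mul_eq_zero_iff hf, h.integral_div_one_add_sq_mul_eq_zero_iff hm hf]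
  refine ⟨fun ⟨hlt, hpos, hneg⟩ n hn => ?_,
    fun hle => ⟨fun n hn => hle n hn.le, hle m (by simp), hle (-m) (by simp)⟩⟩
  obtain hn | hn := hn.lt_or_eq
  · exact hlt n hn
  · obtain rfl | rfl := (abs_eq (by positivity)).1 hn
    exacts [hpos, hneg]

lemma IsBoundStateFamily.orthPsi_cas (hm : 1 ≤ m) (h : IsBoundStateFamily m E φ χ) {n : ℤ}
    (hn : (m : ℤ) < |n|) : OrthPsi m φ χ (cas n) :=
  (h.orthPsi_iff hm (memHdotHalf_cas n).integrable).2 fun k hk => by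
    rw [casCoeff_cas, Pi.single_eq_of_ne]
    rintro rfl
    exact hk.not_gt hn

end BoundStates

/-! ### Coercivity -/

lemma one_div_mul_hdotNormSq_le_LplusForm {m : ℕ} {f : ℝ → ℝ} (hf : MemHdotHalf f)
    (h0 : ∀ n : ℤ, |n| ≤ m → casCoeff f n = 0) :
    1 / ((m : ℝ) + 1) * hdotNormSq f ≤ LplusForm m f f := by
  refine hasSum_le (fun n => ?_) ((hasSum_hdotNormSq hf).mul_left (1 / ((m : ℝ) + 1)))
    (hasSum_LplusForm m hf hf)
  by_cases hn : |n| ≤ m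
  · simp [h0 n hn]
  have habs : (m : ℝ) + 1 ≤ |(n : ℝ)| := by exact_mod_cast not_le.1 hn
  have hmul : 1 / ((m : ℝ) + 1) * |(n : ℝ)| ≤ |(n : ℝ)| - m := by
    rw [one_div_mul_eq_div, div_le_iff₀ (by positivity)]
    nlinarith [Nat.cast_nonneg (α := ℝ) m]
  calc 1 / ((m : ℝ) + 1) * (2 * Real.pi * (|(n : ℝ)| * casCoeff f n ^ 2))
      = 2 * Real.pi * (1 / ((m : ℝ) + 1) * |(n : ℝ)| * (casCoeff f n * casCoeff f n)) := by ring
    _ ≤ 2 * Real.pi * ((|(n : ℝ)| - m) * (casCoeff f n * casCoeff f n)) := by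
        gcongr
        exact mul_self_nonneg _

lemma hdotNormSq_cas (n : ℤ) : hdotNormSq (cas n) = 2 * Real.pi * |(n : ℝ)| := by
  refine (hasSum_hdotNormSq (memHdotHalf_cas n)).unique ?_
  convert hasSum_ite_eq n (2 * Real.pi * |(n : ℝ)|) using 2 with k
  obtain rfl | hk := eq_or_ne k n
  · simp [casCoeff_cas]
  · simp [casCoeff_cas, hk]

lemma LplusForm_cas_self (m : ℕ) (n : ℤ) :
    LplusForm m (cas n) (cas n) = 2 * Real.pi * (|(n : ℝ)| - m) := by
  refine (hasSum_LplusForm m (memHdotHalf_cas n) (memHdotHalf_cas n)).unique ?_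
  convert hasSum_ite_eq n (2 * Real.pi * (|(n : ℝ)| - m)) using 2 with k
  obtain rfl | hk := eq_or_ne k n
  · simp [casCoeff_cas]
  · simp [casCoeff_cas, hk]

lemma memHdotHalf_zero : MemHdotHalf 0 := energySpace.zero_mem

lemma orthPsi_zero (m : ℕ) (φ : Fin (2 * m) → ℝ → ℝ) (χ : ℝ → ℝ) : OrthPsi m φ χ 0 :=
  fun k => by simp

lemma hdotNormSq_zero : hdotNormSq 0 = 0 := by
  simp [hdotNormSq, halfLapForm]

lemma LminusForm_zero (m : ℕ) : LminusForm m 0 0 = 0 := by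
  simp [LminusForm, LplusForm, halfLapForm]

end

end HalfWave

theorem corollary1 (m : ℕ) (hm : 1 ≤ m) :
    -- the functions `φ_k` and the resonance exist, and the `φ_k` are, up to scalar factors,
    -- all the eigenfunctions with eigenvalue at most zero
    (∃ (E : Fin (2 * m) → ℝ) (φ : Fin (2 * m) → ℝ → ℝ) (χ : ℝ → ℝ),
      HalfWave.IsBoundStateFamily m E φ χ ∧
      ∀ (e : ℝ) (u : ℝ → ℝ), e ≤ 0 → HalfWave.IsEigenfunction m e u →
        ∃ (k : Fin (2 * m)) (c : ℝ), e = E k ∧ u =ᵐ[MeasureTheory.volume] fun x => c * φ k x) ∧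
    ∀ (E : Fin (2 * m) → ℝ) (φ : Fin (2 * m) → ℝ → ℝ) (χ : ℝ → ℝ),
      HalfWave.IsBoundStateFamily m E φ χ →
      -- all integrals in the claim converge absolutely on the energy space
      (∀ f : ℝ → ℝ, HalfWave.MemHdotHalf f →
        (∀ k, MeasureTheory.Integrable (fun x : ℝ => HalfWave.psi m φ χ k x * f x)) ∧
        MeasureTheory.Integrable (fun x : ℝ => 2 * (m : ℝ) / (1 + x ^ 2) * (f x * f x)) ∧
        (∀ x : ℝ, MeasureTheory.Integrable (fun y : ℝ =>
          ‖HalfWave.Qmap m x - HalfWave.Qmap m y‖ ^ 2 / (x - y) ^ 2 * f y)) ∧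
        MeasureTheory.Integrable (fun x : ℝ => f x * HalfWave.Rop m f x)) ∧
      -- the coercivity estimate
      (∀ f g : ℝ → ℝ, HalfWave.MemHdotHalf f → HalfWave.MemHdotHalf g →
        HalfWave.OrthPsi m φ χ f → HalfWave.OrthPsi m φ χ g →
        HalfWave.LplusForm m f f + HalfWave.LminusForm m g g ≥
          1 / ((m : ℝ) + 1) * (HalfWave.hdotNormSq f + HalfWave.hdotNormSq g)) ∧
      -- the constant is optimal
      (∀ c : ℝ,
        (∀ f g : ℝ → ℝ, HalfWave.MemHdotHalf f → HalfWave.MemHdotHalf g →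
          HalfWave.OrthPsi m φ χ f → HalfWave.OrthPsi m φ χ g →
          HalfWave.LplusForm m f f + HalfWave.LminusForm m g g ≥
            c * (HalfWave.hdotNormSq f + HalfWave.hdotNormSq g)) →
        c ≤ 1 / ((m : ℝ) + 1)) := by
  refine ⟨HalfWave.exists_isBoundStateFamily hm, fun E φ χ h =>
    ⟨fun f hf => ⟨h.integrable_psi_mul hm hf, ?_, ?_, ?_⟩, fun f g hf hg hfψ hgψ => ?_,
      fun c hc => ?_⟩⟩
  · exact HalfWave.integrable_div_one_add_sq_mul (hf.memLp.integrable_mul hf.memLp) _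
  · exact HalfWave.integrable_norm_Qmap_sub_sq_div_mul m hf.integrable
  · exact HalfWave.integrable_mul_Rop m hf.integrable
  · have hfL := HalfWave.one_div_mul_hdotNormSq_le_LplusForm hf
      ((h.orthPsi_iff hm hf.integrable).1 hfψ)
    have hgL := HalfWave.one_div_mul_hdotNormSq_le_LplusForm hg
      ((h.orthPsi_iff hm hg.integrable).1 hgψ)
    have hR := HalfWave.LplusForm_le_LminusForm m hg.integrable
    linarith
  · have habs : |((m + 1 : ℤ) : ℝ)| = m + 1 := by
      push_cast
      exact abs_of_nonneg (by positivity)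
    have hcas := hc _ 0 (HalfWave.memHdotHalf_cas (m + 1)) HalfWave.memHdotHalf_zero
      (h.orthPsi_cas hm (lt_abs.2 (.inl (by lia)))) (HalfWave.orthPsi_zero m φ χ)
    rw [HalfWave.LplusForm_cas_self, HalfWave.LminusForm_zero, HalfWave.hdotNormSq_cas,
      HalfWave.hdotNormSq_zero, habs] at hcas
    rw [le_div_iff₀ (by positivity)]
    refine le_of_mul_le_mul_left ?_ Real.two_pi_pos
    linarith
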